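/- Algebras are associative and unital, coalgebras are coassociative and counital, and Sweedler notation $\Delta(c)=c_1\otimes c_2$ is used. Consider one of the following structures: (a) an algebra $A$ over a field $k$, possibly equipped with a linear functional $\tau:A\to k$, and possibly with a distinguished subalgebra $A'\subseteq A$; (b) a complex $*$-algebra $A$, possibly equipped with a linear functional $\tau:A\to\mathbb C$, and possibly with a distinguished subalgebra $A'\subseteq A$ (for instance a $*$-subalgebra). A coalgebra $C$ *measures* the structure via a linear map $C\otimes A\to A$, $c\otimes a\mapsto c\triangleright a$, if $c\triangleright(ab)=(c_1\triangleright a)(c_2\triangleright b)$ and $c\triangleright 1=\varepsilon(c)1$ for all $c\in C$ and $a,b\in A$; if $\tau(c\triangleright a)=\varepsilon(c)\tau(a)$ for all $c,a$ (when $\tau$ is given); and if $c\triangleright a=\varepsilon(c)a$ for all $c\in C$, $a\in A'$ (when $A'$ is given). In case (b), $C$ is required to be a $*$-coalgebra, i.e. a complex coalgebra with a conjugate-linear involution such that $\Delta(c^*)=c_2^*\otimes c_1^*$, and additionally $(c\triangleright a)^*=c^*\triangleright a^*$ for all $c,a$. Then: 1. There is a universal measuring coalgebra ($*$-coalgebra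 in case (b)): a coalgebra ($*$-coalgebra) $M$ measuring the structure such that for every coalgebra ($*$-coalgebra) $C$ measuring it there is a unique morphism $\psi:C\to M$ of coalgebras ($*$-coalgebras) with $\psi(c)\triangleright a=c\triangleright a$ for all $c,a$. 2. Every universal measuring coalgebra $M$ is automatically a bialgebra: its coalgebra structure extends to a bialgebra structure for which the measuring makes $A$ into an $M$-module, and $M$ is then also universal (terminal) among the bialgebras $B$ that measure the structure through a $B$-module structure on $A$. In case (b) the involution of the $*$-coalgebra $M$ satisfies $(xy)^*=x^*y^*$ and $1^*=1$ for this product, the universal property is among bialgebras $B$ that are $*$-coalgebras with an involution of this kind, and the morphisms preserve the involutions. 3. There is a universal Hopf algebra (Hopf $*$-algebra in case (b)) acting on the structure. In case (a): a Hopf algebra $H$ with an $H$-module structure on $A$ that measures the structure, such that for every other such Hopf algebra $H'$ there is a unique Hopf algebra morphism $f:H'\to H$ with $f(h)\triangleright a=h\triangleright a$ for all $h\in H'$, $a\in A$. In case (b) the same holds for Hopf $*$-algebras (complex Hopf algebras that are $*$-algebras such that $\Delta$ is a $*$-morphism and $h\mapsto S(h)^*$ is an involution), whose actions measure the underlying algebra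 with $\tau$ and $A'$ and satisfy $(h\triangleright a)^*=S(h)^*\triangleright a^*$, and for morphisms of Hopf $*$-algebras. -/

import Mathlib

open scoped TensorProduct

universe u v

namespace Measuring

/-! ### Algebras over a field -/

/-- Let `A` be a unital `k`-algebra, possibly with a linear functional `τ` and possibly with a
distinguished subalgebra `A'` (the value `none` means that the datum is absent).
A linear map `act : C → End(A)`, written `c ▷ a = act c a`, from a coalgebra `C` is a measuring of
the whole structure if, in Sweedler notation,
`c ▷ (a b) = (c₁ ▷ a)(c₂ ▷ b)`, `c ▷ 1 = ε(c) 1`, `τ(c ▷ a) = ε(c) τ(a)` for all `a ∈ A`,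
and `c ▷ a = ε(c) a` for all `a ∈ A'`. -/
structure IsMeasuring {k : Type*} [Field k] {A : Type*} [Ring A] [Algebra k A]
    (τ : Option (A →ₗ[k] k)) (A' : Option (Subalgebra k A))
    {C : Type*} [AddCommGroup C] [Module k C] [Coalgebra k C]
    (act : C →ₗ[k] Module.End k A) : Prop where
  act_mul : ∀ (c : C) (a b : A), act c (a * b) =
    LinearMap.mul' k A
      (TensorProduct.map (act.flip a) (act.flip b) (Coalgebra.comul (R := k) c))
  act_one : ∀ c : C, act c 1 = algebraMap k A (Coalgebra.counit (R := k) c)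
  functional : ∀ t ∈ τ, ∀ (c : C) (a : A), t (act c a) = Coalgebra.counit (R := k) c * t a
  fixes : ∀ S ∈ A', ∀ (c : C), ∀ a ∈ S, act c a = Coalgebra.counit (R := k) c • a

/-- `(M, act)` is a universal measuring coalgebra: a terminal object among the coalgebras that
measure `(A, τ, A')`. -/
def IsUniversalCoalgebra {k : Type u} [Field k] {A : Type v} [Ring A] [Algebra k A]
    (τ : Option (A →ₗ[k] k)) (A' : Option (Subalgebra k A))
    {M : Type (max u v)} [AddCommGroup M] [Module k M] [Coalgebra k M]
    (act : M →ₗ[k] Module.End k A) : Prop :=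
  IsMeasuring τ A' act ∧
    ∀ (C : Type (max u v)) [AddCommGroup C] [Module k C] [Coalgebra k C]
      (β : C →ₗ[k] Module.End k A), IsMeasuring τ A' β →
      ∃! f : C →ₗc[k] M, ∀ (c : C) (a : A), act (f c) a = β c a

/-- `(B, ρ)` is a universal measuring bialgebra: `ρ` makes `A` a `B`-module, it is a measuring of
`(A, τ, A')`, and `(B, ρ)` is terminal among such bialgebras. -/
def IsUniversalBialgebra {k : Type u} [Field k] {A : Type v} [Ring A] [Algebra k A]
    (τ : Option (A →ₗ[k] k)) (A' : Option (Subalgebra k A))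
    {B : Type (max u v)} [Ring B] [Bialgebra k B]
    (ρ : B →ₐ[k] Module.End k A) : Prop :=
  IsMeasuring τ A' ρ.toLinearMap ∧
    ∀ (D : Type (max u v)) [Ring D] [Bialgebra k D] (σ : D →ₐ[k] Module.End k A),
      IsMeasuring τ A' σ.toLinearMap →
      ∃! f : D →ₐc[k] B, ∀ (d : D) (a : A), ρ (f d) a = σ d a

/-- `(H, ρ)` is a universal measuring Hopf algebra: `ρ` makes `A` an `H`-module algebra, preserving
`τ` and fixing `A'`, and `(H, ρ)` is terminal among Hopf algebras with such an action. (A bialgebra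
morphism between Hopf algebras automatically commutes with the antipodes.) -/
def IsUniversalHopf {k : Type u} [Field k] {A : Type v} [Ring A] [Algebra k A]
    (τ : Option (A →ₗ[k] k)) (A' : Option (Subalgebra k A))
    {H : Type (max u v)} [Ring H] [HopfAlgebra k H]
    (ρ : H →ₐ[k] Module.End k A) : Prop :=
  IsMeasuring τ A' ρ.toLinearMap ∧
    ∀ (D : Type (max u v)) [Ring D] [HopfAlgebra k D] (σ : D →ₐ[k] Module.End k A),
      IsMeasuring τ A' σ.toLinearMap →
      ∃! f : D →ₐc[k] H, ∀ (d : D) (a : A), ρ (f d) a = σ d a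

/-! ### Complex `∗`-algebras -/

/-- A complex `∗`-coalgebra: a coalgebra with a conjugate-linear involution that reverses the
comultiplication, `Δ(c^*) = c₂^* ⊗ c₁^*`. (The star of `C ⊗ C` is `(x ⊗ y)^* = x^* ⊗ y^*`.) -/
class IsStarCoalgebra (C : Type*) [AddCommGroup C] [Module ℂ C] [Coalgebra ℂ C]
    [StarAddMonoid C] [StarModule ℂ C] : Prop where
  comul_star : ∀ c : C, Coalgebra.comul (R := ℂ) (star c) =
    TensorProduct.comm ℂ C C (star (Coalgebra.comul (R := ℂ) c))

/-- A bialgebra whose coalgebra is a `∗`-coalgebra and whose product and unit are morphisms of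
`∗`-coalgebras `B ⊗ B → B` and `ℂ → B`, that is, the involution is multiplicative and unital. -/
class IsStarBialgebra (B : Type*) [Ring B] [Bialgebra ℂ B]
    [StarAddMonoid B] [StarModule ℂ B] : Prop extends IsStarCoalgebra B where
  star_mul_same : ∀ x y : B, star (x * y) = star x * star y
  star_one_same : star (1 : B) = 1

/-- A Hopf `∗`-algebra: a complex Hopf algebra that is a `∗`-algebra (`StarRing`, `StarModule`)
such that `Δ` is a morphism of `∗`-algebras and `h ↦ S(h)^*` is an involution. -/
class IsHopfStar (H : Type*) [Ring H] [HopfAlgebra ℂ H] [StarRing H] [StarModule ℂ H] :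
    Prop where
  comul_star : ∀ h : H, Coalgebra.comul (R := ℂ) (star h) = star (Coalgebra.comul (R := ℂ) h)
  star_antipode_star_antipode : ∀ h : H,
    star (HopfAlgebra.antipode ℂ (star (HopfAlgebra.antipode ℂ h))) = h

/-- A measuring of a `∗`-algebra (with `τ` and `A'` as in `IsMeasuring`) by a `∗`-coalgebra:
in addition `(c ▷ a)^* = c^* ▷ a^*`. -/
structure IsStarMeasuring {A : Type*} [Ring A] [StarRing A] [Algebra ℂ A] [StarModule ℂ A]
    (τ : Option (A →ₗ[ℂ] ℂ)) (A' : Option (Subalgebra ℂ A))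
    {C : Type*} [AddCommGroup C] [Module ℂ C] [Coalgebra ℂ C] [StarAddMonoid C]
    (act : C →ₗ[ℂ] Module.End ℂ A) : Prop extends IsMeasuring τ A' act where
  star_act : ∀ (c : C) (a : A), star (act c a) = act (star c) (star a)

/-- An action of a Hopf `∗`-algebra `H` making `A` a module `∗`-algebra, preserving `τ` and fixing
`A'`: here the compatibility with the involutions is `(h ▷ a)^* = S(h)^* ▷ a^*`. -/
structure IsHopfStarAction {A : Type*} [Ring A] [StarRing A] [Algebra ℂ A] [StarModule ℂ A]
    (τ : Option (A →ₗ[ℂ] ℂ)) (A' : Option (Subalgebra ℂ A))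
    {H : Type*} [Ring H] [HopfAlgebra ℂ H] [StarRing H]
    (ρ : H →ₐ[ℂ] Module.End ℂ A) : Prop extends IsMeasuring τ A' ρ.toLinearMap where
  star_act : ∀ (h : H) (a : A),
    star (ρ h a) = ρ (star (HopfAlgebra.antipode ℂ h)) (star a)

/-- `(M, act)` is terminal among the `∗`-coalgebras that measure `(A, ∗, τ, A')`. -/
def IsUniversalStarCoalgebra {A : Type v} [Ring A] [StarRing A] [Algebra ℂ A] [StarModule ℂ A]
    (τ : Option (A →ₗ[ℂ] ℂ)) (A' : Option (Subalgebra ℂ A))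
    {M : Type v} [AddCommGroup M] [Module ℂ M] [Coalgebra ℂ M]
    [StarAddMonoid M] [StarModule ℂ M] [IsStarCoalgebra M]
    (act : M →ₗ[ℂ] Module.End ℂ A) : Prop :=
  IsStarMeasuring τ A' act ∧
    ∀ (C : Type v) [AddCommGroup C] [Module ℂ C] [Coalgebra ℂ C]
      [StarAddMonoid C] [StarModule ℂ C] [IsStarCoalgebra C]
      (β : C →ₗ[ℂ] Module.End ℂ A), IsStarMeasuring τ A' β →
      ∃! f : C →ₗc[ℂ] M, (∀ c : C, f (star c) = star (f c)) ∧
        ∀ (c : C) (a : A), act (f c) a = β c a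

/-- `(B, ρ)` is terminal among the bialgebras in `∗`-coalgebras that act on, and measure,
`(A, ∗, τ, A')`. -/
def IsUniversalStarBialgebra {A : Type v} [Ring A] [StarRing A] [Algebra ℂ A] [StarModule ℂ A]
    (τ : Option (A →ₗ[ℂ] ℂ)) (A' : Option (Subalgebra ℂ A))
    {B : Type v} [Ring B] [Bialgebra ℂ B]
    [StarAddMonoid B] [StarModule ℂ B] [IsStarBialgebra B]
    (ρ : B →ₐ[ℂ] Module.End ℂ A) : Prop :=
  IsStarMeasuring τ A' ρ.toLinearMap ∧
    ∀ (D : Type v) [Ring D] [Bialgebra ℂ D]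
      [StarAddMonoid D] [StarModule ℂ D] [IsStarBialgebra D]
      (σ : D →ₐ[ℂ] Module.End ℂ A), IsStarMeasuring τ A' σ.toLinearMap →
      ∃! f : D →ₐc[ℂ] B, (∀ d : D, f (star d) = star (f d)) ∧
        ∀ (d : D) (a : A), ρ (f d) a = σ d a

/-- `(H, ρ)` is terminal among the Hopf `∗`-algebras acting on `(A, ∗, τ, A')`. -/
def IsUniversalHopfStar {A : Type v} [Ring A] [StarRing A] [Algebra ℂ A] [StarModule ℂ A]
    (τ : Option (A →ₗ[ℂ] ℂ)) (A' : Option (Subalgebra ℂ A))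
    {H : Type v} [Ring H] [HopfAlgebra ℂ H] [StarRing H] [StarModule ℂ H] [IsHopfStar H]
    (ρ : H →ₐ[ℂ] Module.End ℂ A) : Prop :=
  IsHopfStarAction τ A' ρ ∧
    ∀ (D : Type v) [Ring D] [HopfAlgebra ℂ D] [StarRing D] [StarModule ℂ D] [IsHopfStar D]
      (σ : D →ₐ[ℂ] Module.End ℂ A), IsHopfStarAction τ A' σ →
      ∃! f : D →ₐc[ℂ] H, (∀ d : D, f (star d) = star (f d)) ∧
        ∀ (d : D) (a : A), ρ (f d) a = σ d a

end Measuring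

/-! Everything reduces to terminal objects among coalgebras `C` with a linear map `β : C → V`,
subject to conditions that can be tested on a jointly surjective family of coalgebra maps. Pairing
iterated comultiplications with words in functionals on `V` gives `wordMap β` from `C` to the dual
of the free algebra on `V*`. Its kernel is a coideal inside `ker β`, so `C` has a quotient that
embeds in a space depending only on `V`. Hence there is a set of representatives. Their direct sum,
divided by the kernel of its own `wordMap`, is terminal: the words separate its points and determine
every map into it (`IsLocalProperty.exists_isTerminalOver`).

For measurings take `V = End A`. Composing two measurings gives a measuring of `M ⊗ M`, so
terminality yields a product on `M`. Its laws follow from coinduction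
(`IsUniversalFamily.coinduction`): a terminal object has no nonzero coideal in the kernel of its
action.

For Hopf algebras the antipode is encoded in the data being classified. An action `σ` yields the
sequence `βₙ = σ ∘ Sⁿ`, alternately measurings of the coalgebra and of its co-opposite, with `βₙ₊₁`
the convolution inverse of `βₙ`. Take the terminal coalgebra with such a sequence, so `V = ℕ → End
A`. It is a bialgebra as before, and the shift `n ↦ n + 1` induces a map from its co-opposite to
itself, which is the antipode (`IsUniversalModule.exists_hopfAlgebra`).

In the `∗`-case, invariance of `τ` and `A'` forces invariance of their conjugates, so the data may
be made self-adjoint. Conjugating the actions then induces the involution by terminality. The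
antipode of a Hopf `∗`-algebra is invertible, so the index set becomes `ℤ`. From `(h ▷ a)^* = S(h)^*
▷ a^*` one gets that `βₙ(h^*)` is the conjugate of `β₋₁₋ₙ(h)`, so the involution comes from the
reflection `n ↦ -1 - n`. -/

namespace Measuring

open Coalgebra Module

/-! ### Terminal coalgebras over a vector space -/

section Terminal

variable {k : Type u} [Field k]

/-- Expand a tensor along a basis of `W*`. If the bilinear form vanishes, fixing `u` gives a linear
relation among the basis functionals, so every coefficient vanishes at `u`. -/
theorem dualDistrib_injective {U W : Type*} [AddCommGroup U] [Module k U] [AddCommGroup W]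
    [Module k W] : Function.Injective (TensorProduct.dualDistrib k U W) := by
  classical
  let b := Basis.ofVectorSpace k (Dual k W)
  refine (injective_iff_map_eq_zero _).2 fun x hx => ?_
  obtain ⟨c, rfl⟩ := (TensorProduct.equivFinsuppOfBasisRight b).symm.surjective x
  suffices c = 0 by simp [this]
  ext i u
  have h : Finsupp.linearCombination k b (c.mapRange (fun φ => φ u) (by simp)) = 0 := by
    ext w
    have := LinearMap.congr_fun hx (u ⊗ₜ w)
    rw [TensorProduct.equivFinsuppOfBasisRight_symm_apply] at this
    simp only [Finsupp.sum, map_sum, LinearMap.sum_apply, TensorProduct.dualDistrib_apply] at this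
    rw [Finsupp.linearCombination_apply, Finsupp.sum_mapRange_index (by simp)]
    simpa [Finsupp.sum, LinearMap.sum_apply] using this
  have h0 := linearIndependent_iff.1 b.linearIndependent _ h
  simpa using DFunLike.congr_fun h0 i

section Words

variable {V : Type v} [AddCommGroup V] [Module k V]

/-- The space of functionals on noncommutative polynomials in the functionals on `V`. -/
abbrev WordDual (k : Type u) [Field k] (V : Type v) [AddCommGroup V] [Module k V] :
    Type (max u v) :=
  Dual k (FreeAlgebra k (Dual k V))

variable {C D : Type*} [AddCommGroup C] [Module k C] [Coalgebra k C]
  [AddCommGroup D] [Module k D] [Coalgebra k D]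

/-- A word `φ₁ ⋯ φₙ` of functionals on `V` sends `c` to `φ₁ (β c₁) ⋯ φₙ (β cₙ)`. -/
noncomputable def evalWord (β : C →ₗ[k] V) :
    FreeAlgebra k (Dual k V) →ₐ[k] WithConv (C →ₗ[k] k) :=
  FreeAlgebra.lift k fun φ => WithConv.toConv (φ ∘ₗ β)

/-- The target does not depend on `C`, which is what bounds the size of the coalgebras to be
considered. -/
noncomputable def wordMap (β : C →ₗ[k] V) : C →ₗ[k] WordDual k V :=
  ((WithConv.linearEquiv k (C →ₗ[k] k)).toLinearMap ∘ₗ (evalWord β).toLinearMap).flip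

theorem wordMap_apply (β : C →ₗ[k] V) (c : C) (w : FreeAlgebra k (Dual k V)) :
    wordMap β c w = (evalWord β w).ofConv c := rfl

theorem wordMap_one (β : C →ₗ[k] V) (c : C) : wordMap β c 1 = counit (R := k) c := by
  rw [wordMap_apply, map_one]
  simp [LinearMap.convOne_def]

theorem wordMap_ι (β : C →ₗ[k] V) (c : C) (φ : Dual k V) :
    wordMap β c (FreeAlgebra.ι k φ) = φ (β c) := by
  rw [wordMap_apply, evalWord, FreeAlgebra.lift_ι_apply]
  rfl

/-- Evaluation of words is an algebra map to the convolution algebra, so concatenation is dual to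
comultiplication. -/
theorem wordMap_mul (β : C →ₗ[k] V) (c : C) (w w' : FreeAlgebra k (Dual k V)) :
    wordMap β c (w * w') =
      TensorProduct.dualDistrib k _ _ (TensorProduct.map (wordMap β) (wordMap β)
        (comul (R := k) c)) (w ⊗ₜ w') := by
  rw [wordMap_apply, map_mul, (ℛ k c).convMul_apply, ← (ℛ k c).eq]
  simp [TensorProduct.dualDistrib_apply, wordMap_apply]

/-- Words are evaluated through the coalgebra structure and `β` alone. Thus a morphism over `V` is
determined as soon as the `wordMap` of its target is injective. -/
theorem wordMap_comp (β : D →ₗ[k] V) (f : C →ₗc[k] D) :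
    wordMap (β ∘ₗ (f : C →ₗ[k] D)) = wordMap β ∘ₗ (f : C →ₗ[k] D) := by
  ext c w
  simp only [LinearMap.comp_apply, CoalgHom.coe_toLinearMap]
  induction w using FreeAlgebra.induction generalizing c with
  | grade0 r =>
    rw [Algebra.algebraMap_eq_smul_one]
    simp [wordMap_one]
  | grade1 φ => simp [wordMap_ι]
  | add a b ha hb => rw [map_add, map_add, ha, hb]
  | mul a b ha hb =>
    rw [wordMap_mul, wordMap_mul, ← CoalgHomClass.map_comp_comul_apply, ← (ℛ k c).eq]
    simp [TensorProduct.dualDistrib_apply, ha, hb]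

/-- The quotient by the kernel embeds in the word dual, and its tensor square embeds in bilinear
forms on words. There the comultiplication of `x` becomes `(w, w') ↦ wordMap β x (w * w')`, which is
zero for `x` in the kernel. -/
instance wordMap_ker_isCoideal (β : C →ₗ[k] V) : (LinearMap.ker (wordMap β)).IsCoideal where
  counit_eq_zero x hx := by
    rw [← wordMap_one β, LinearMap.mem_ker.1 hx, LinearMap.zero_apply]
  map_mkQ_comul_eq_zero x hx := by
    set K := LinearMap.ker (wordMap β)
    have hinj : Function.Injective (K.liftQ (wordMap β) le_rfl) :=
      LinearMap.ker_eq_bot.1 (Submodule.ker_liftQ_eq_bot _ _ _ le_rfl)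
    apply TensorProduct.map_injective_of_flat_flat _ _ hinj hinj
    rw [TensorProduct.map_map, map_zero, Submodule.liftQ_mkQ]
    apply dualDistrib_injective
    rw [map_zero]
    ext w w'
    simp only [TensorProduct.AlgebraTensorModule.curry_apply, TensorProduct.curry_apply,
      LinearMap.coe_restrictScalars, LinearMap.zero_apply]
    rw [← wordMap_mul, LinearMap.mem_ker.1 hx, LinearMap.zero_apply]

/-- Words of length one already detect `β c`, because functionals separate the points of `V`. -/
theorem wordMap_ker_le (β : C →ₗ[k] V) : LinearMap.ker (wordMap β) ≤ LinearMap.ker β := by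
  intro c hc
  rw [LinearMap.mem_ker, ← Module.forall_dual_apply_eq_zero_iff k]
  intro φ
  rw [← wordMap_ι β, LinearMap.mem_ker.1 hc, LinearMap.zero_apply]

end Words

variable {V : Type v} [AddCommGroup V] [Module k V]

/-- A property of coalgebras over a vector space `V` that can be tested on the members of a jointly
surjective family of coalgebra maps. -/
def IsLocalProperty
    (Q : ∀ (C : Type (max u v)) [AddCommGroup C] [Module k C] [Coalgebra k C],
      (C →ₗ[k] V) → Prop) : Prop :=
  ∀ (D : Type (max u v)) [AddCommGroup D] [Module k D] [Coalgebra k D] (β : D →ₗ[k] V)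
    (J : Type (max u v)) (C : J → Type (max u v)) [∀ j, AddCommGroup (C j)] [∀ j, Module k (C j)]
    [∀ j, Coalgebra k (C j)] (f : ∀ j, C j →ₗc[k] D),
    (∀ j, Q (C j) (β ∘ₗ (f j : C j →ₗ[k] D))) →
    (⨆ j, LinearMap.range (f j : C j →ₗ[k] D)) = ⊤ → Q D β

/-- `(M, β)` is terminal among the coalgebras over `V` with the property `Q`. -/
def IsTerminalOver
    (Q : ∀ (C : Type (max u v)) [AddCommGroup C] [Module k C] [Coalgebra k C],
      (C →ₗ[k] V) → Prop)
    {M : Type (max u v)} [AddCommGroup M] [Module k M] [Coalgebra k M] (β : M →ₗ[k] V) : Prop :=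
  Q M β ∧ ∀ (C : Type (max u v)) [AddCommGroup C] [Module k C] [Coalgebra k C] (γ : C →ₗ[k] V),
    Q C γ → ∃! f : C →ₗc[k] M, β ∘ₗ (f : C →ₗ[k] M) = γ

variable {Q : ∀ (C : Type (max u v)) [AddCommGroup C] [Module k C] [Coalgebra k C],
      (C →ₗ[k] V) → Prop}

theorem IsLocalProperty.of_surjective (hQ : IsLocalProperty Q)
    {C D : Type (max u v)} [AddCommGroup C] [Module k C] [Coalgebra k C]
    [AddCommGroup D] [Module k D] [Coalgebra k D] {β : D →ₗ[k] V} (f : C →ₗc[k] D)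
    (hf : Function.Surjective f) (h : Q C (β ∘ₗ (f : C →ₗ[k] D))) : Q D β :=
  hQ D β PUnit (fun _ => C) (fun _ => f) (fun _ => h) <| by
    exact top_le_iff.1 (le_iSup_of_le PUnit.unit (LinearMap.range_eq_top.2 hf).ge)

/-- The coalgebras with property `Q` whose underlying space is a subspace of `WordDual k V`. -/
structure SmallCoalgebra
    (Q : ∀ (C : Type (max u v)) [AddCommGroup C] [Module k C] [Coalgebra k C],
      (C →ₗ[k] V) → Prop) : Type (max u v) where
  carrier : Submodule k (WordDual k V)
  coalg : Coalgebra k carrier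
  proj : carrier →ₗ[k] V
  prop : Q carrier proj

attribute [instance] SmallCoalgebra.coalg

/-- Transport of a coalgebra structure along a linear equivalence. -/
@[reducible]
noncomputable def coalgebraStructOfEquiv {C D : Type*} [AddCommMonoid C] [Module k C]
    [Coalgebra k C] [AddCommMonoid D] [Module k D] (e : C ≃ₗ[k] D) : CoalgebraStruct k D where
  comul := TensorProduct.map e.toLinearMap e.toLinearMap ∘ₗ comul ∘ₗ e.symm.toLinearMap
  counit := counit ∘ₗ e.symm.toLinearMap

@[reducible]
noncomputable def coalgEquivOfEquiv {C D : Type*} [AddCommMonoid C] [Module k C]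
    [Coalgebra k C] [AddCommMonoid D] [Module k D] (e : C ≃ₗ[k] D) :
    letI := coalgebraStructOfEquiv e
    C ≃ₗc[k] D :=
  letI := coalgebraStructOfEquiv e
  { e with
    counit_comp := by ext x; simp [counit]
    map_comp_comul := by ext x; simp [comul] }

/-- The inclusion of a summand into a direct sum of coalgebras. -/
noncomputable def dfinsuppSingle (k : Type*) [Field k] {J : Type*} [DecidableEq J] (C : J → Type*)
    [∀ j, AddCommMonoid (C j)] [∀ j, Module k (C j)] [∀ j, Coalgebra k (C j)] (j : J) :
    C j →ₗc[k] Π₀ j, C j :=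
  { DFinsupp.lsingle j with
    counit_comp := DFinsupp.counit_comp_lsingle k J C j
    map_comp_comul := (DFinsupp.comul_comp_lsingle k J C j).symm }

/-- The quotient of `C` by the kernel of `wordMap γ` is isomorphic to the range, a subspace of
`WordDual k V`. The structure map descends to it, and `Q` passes to it by locality. -/
theorem exists_hom_smallCoalgebra (hQ : IsLocalProperty Q)
    (C : Type (max u v)) [AddCommGroup C] [Module k C] [Coalgebra k C] (γ : C →ₗ[k] V)
    (h : Q C γ) : ∃ (s : SmallCoalgebra Q) (f : C →ₗc[k] s.carrier),
      s.proj ∘ₗ (f : C →ₗ[k] s.carrier) = γ := by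
  let K := LinearMap.ker (wordMap γ)
  let e : (C ⧸ K) ≃ₗ[k] LinearMap.range (wordMap γ) := (wordMap γ).quotKerEquivRange
  let _ := coalgebraStructOfEquiv e
  let e' := coalgEquivOfEquiv e
  -- So far only the structure maps were transported; the coalgebra axioms now follow along the
  -- equivalence.
  let _ := e'.toCoalgebra
  let γ' : LinearMap.range (wordMap γ) →ₗ[k] V :=
    K.liftQ γ (wordMap_ker_le γ) ∘ₗ e.symm.toLinearMap
  let f : C →ₗc[k] LinearMap.range (wordMap γ) :=
    (e' : (C ⧸ K) →ₗc[k] _).comp (Quotient.mkQCoalgHom K)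
  have hf : γ' ∘ₗ (f : C →ₗ[k] LinearMap.range (wordMap γ)) = γ := by
    ext x
    change K.liftQ γ (wordMap_ker_le γ) (e.symm (e (K.mkQ x))) = γ x
    simp
  have hs : Function.Surjective f := e.surjective.comp K.mkQ_surjective
  exact ⟨⟨_, inferInstance, γ', hQ.of_surjective f hs (by rwa [hf])⟩, f, hf⟩

theorem IsLocalProperty.exists_directSum (hQ : IsLocalProperty Q) {J : Type (max u v)}
    (C : J → Type (max u v)) [∀ j, AddCommGroup (C j)] [∀ j, Module k (C j)]
    [∀ j, Coalgebra k (C j)] (γ : ∀ j, C j →ₗ[k] V) (h : ∀ j, Q (C j) (γ j)) :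
    ∃ (N : Type (max u v)) (_ : AddCommGroup N) (_ : Module k N) (_ : Coalgebra k N)
      (β : N →ₗ[k] V) (i : ∀ j, C j →ₗc[k] N), Q N β ∧ ∀ j, β ∘ₗ (i j : C j →ₗ[k] N) = γ j := by
  classical
  have hi (j : J) : DFinsupp.lsum k γ ∘ₗ (dfinsuppSingle k C j : C j →ₗ[k] Π₀ j, C j) = γ j := by
    ext x
    exact DFinsupp.lsum_single k γ j x
  refine ⟨Π₀ j, C j, inferInstance, inferInstance, inferInstance, DFinsupp.lsum k γ,
    dfinsuppSingle k C, hQ _ _ J C (dfinsuppSingle k C) (fun j => ?_) ?_, hi⟩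
  · rw [hi]
    exact h j
  · exact DFinsupp.iSup_range_lsingle

/-- The direct sum of all small coalgebras is weakly terminal; dividing by the kernel of `wordMap`
makes words separate points, which gives uniqueness. -/
theorem IsLocalProperty.exists_isTerminalOver (hQ : IsLocalProperty Q) :
    ∃ (M : Type (max u v)) (_ : AddCommGroup M) (_ : Module k M) (_ : Coalgebra k M)
      (β : M →ₗ[k] V), IsTerminalOver Q β := by
  obtain ⟨N, _, _, _, βN, i, hN, hi⟩ := hQ.exists_directSum (fun s : SmallCoalgebra Q => s.carrier)
    (fun s => s.proj) (fun s => s.prop)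
  let K := LinearMap.ker (wordMap βN)
  let βM : (N ⧸ K) →ₗ[k] V := K.liftQ βN (wordMap_ker_le βN)
  let q : N →ₗc[k] N ⧸ K := Quotient.mkQCoalgHom K
  have hq : βM ∘ₗ (q : N →ₗ[k] N ⧸ K) = βN := Submodule.liftQ_mkQ _ _ _
  have hinj : Function.Injective (wordMap βM) := by
    refine (injective_iff_map_eq_zero _).2 fun x hx => ?_
    obtain ⟨x, rfl⟩ := K.mkQ_surjective x
    have h := LinearMap.congr_fun (wordMap_comp βM q) x
    rw [hq] at h
    exact (Submodule.Quotient.mk_eq_zero K).2 (h.trans hx)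
  refine ⟨N ⧸ K, inferInstance, inferInstance, inferInstance, βM,
    hQ.of_surjective q K.mkQ_surjective (by rwa [hq]), fun C _ _ _ γ hγ => ?_⟩
  obtain ⟨s, f, hf⟩ := exists_hom_smallCoalgebra hQ C γ hγ
  refine ⟨(q.comp (i s)).comp f, ?_, fun g hg => ?_⟩
  · change ((βM ∘ₗ (q : N →ₗ[k] N ⧸ K)) ∘ₗ (i s : s.carrier →ₗ[k] N)) ∘ₗ _ = γ
    rw [hq, hi, hf]
  -- All morphisms over `V` have the same words, namely those of `γ`.
  · have key (g : C →ₗc[k] N ⧸ K) (hg : βM ∘ₗ (g : C →ₗ[k] N ⧸ K) = γ) (x : C) :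
        wordMap βM (g x) = wordMap γ x := by
      rw [← hg, wordMap_comp]
      rfl
    ext x
    apply hinj
    rw [key g hg, key]
    change ((βM ∘ₗ (q : N →ₗ[k] N ⧸ K)) ∘ₗ (i s : s.carrier →ₗ[k] N)) ∘ₗ _ = γ
    rw [hq, hi, hf]

/-- The coinduction principle of a terminal coalgebra: a quotient map by a coideal in the kernel of
the structure map is injective. -/
theorem IsTerminalOver.injective_of_ker (hQ : IsLocalProperty Q) {M : Type (max u v)}
    [AddCommGroup M] [Module k M] [Coalgebra k M] {β : M →ₗ[k] V} (hβ : IsTerminalOver Q β)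
    (J : Submodule k M) (hJ : J.IsCoideal) (hJβ : J ≤ LinearMap.ker β) : J = ⊥ := by
  let q : M →ₗc[k] M ⧸ J := Quotient.mkQCoalgHom J
  have hq : J.liftQ β hJβ ∘ₗ (q : M →ₗ[k] M ⧸ J) = β := Submodule.liftQ_mkQ _ _ _
  obtain ⟨g, hg, -⟩ := hβ.2 (M ⧸ J) (J.liftQ β hJβ)
    (hQ.of_surjective q J.mkQ_surjective (by rw [hq]; exact hβ.1))
  obtain ⟨f, -, hf⟩ := hβ.2 M β hβ.1
  -- Both `g ∘ q` and the identity are endomorphisms over `V`, so they agree and `q` is injective.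
  have h1 : g.comp q = f := hf _ <| by
    change (β ∘ₗ (g : M ⧸ J →ₗ[k] M)) ∘ₗ (q : M →ₗ[k] M ⧸ J) = β
    rw [hg, hq]
  have h2 : CoalgHom.id k M = f := hf _ rfl
  rw [eq_bot_iff]
  intro x hx
  have h3 := DFunLike.congr_fun (h1.trans h2.symm) x
  have h4 : q x = 0 := (Submodule.Quotient.mk_eq_zero J).2 hx
  rw [CoalgHom.comp_apply, h4, map_zero] at h3
  exact h3.symm

end Terminal

/-! ### Composite actions and opposite comultiplications -/

section TensorAct

variable {k : Type*} [Field k] {A : Type*} [Ring A] [Algebra k A]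
  {C D : Type*} [AddCommGroup C] [Module k C] [AddCommGroup D] [Module k D]

/-- The action of `C ⊗ D` by composition, in the order given by the parity. -/
noncomputable def tensorAct (p : Bool) (β : C →ₗ[k] Module.End k A) (γ : D →ₗ[k] Module.End k A) :
    C ⊗[k] D →ₗ[k] Module.End k A :=
  bif p then LinearMap.mul' k _ ∘ₗ TensorProduct.map γ β ∘ₗ (TensorProduct.comm k C D).toLinearMap
  else LinearMap.mul' k _ ∘ₗ TensorProduct.map β γ

@[simp] theorem tensorAct_tmul (p : Bool) (β : C →ₗ[k] Module.End k A)
    (γ : D →ₗ[k] Module.End k A) (x : C) (y : D) :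
    tensorAct p β γ (x ⊗ₜ y) = bif p then γ y * β x else β x * γ y := by
  cases p <;> rfl

theorem linearMap_tensor_ext {X : Type*} [AddCommGroup X] [Module k X] {L L' : C ⊗[k] D →ₗ[k] X}
    (h : ∀ x y, L (x ⊗ₜ y) = L' (x ⊗ₜ y)) (z : C ⊗[k] D) : L z = L' z :=
  LinearMap.congr_fun (TensorProduct.ext' h) z

end TensorAct

section TwistedComul

variable {k : Type*} [Field k] {C D : Type*} [AddCommGroup C] [Module k C] [Coalgebra k C]
  [AddCommGroup D] [Module k D] [Coalgebra k D]

/-- The comultiplication (for `false`) or the opposite comultiplication (for `true`). -/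
noncomputable def twComul (k : Type*) [Field k] {C : Type*} [AddCommGroup C] [Module k C]
    [Coalgebra k C] (p : Bool) : C →ₗ[k] C ⊗[k] C :=
  bif p then (TensorProduct.comm k C C).toLinearMap ∘ₗ comul else comul

@[simp] theorem twComul_false : twComul k (C := C) false = comul := rfl

theorem twComul_true_apply (c : C) :
    twComul k true c = TensorProduct.comm k C C (comul c) := rfl

theorem comm_twComul (p : Bool) (c : C) :
    TensorProduct.comm k C C (twComul k p c) = twComul k (!p) c := by
  cases p
  · rfl
  · change TensorProduct.comm k C C (TensorProduct.comm k C C (comul c)) = comul c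
    simp

theorem exists_twComul_eq_sum (p : Bool) (c : C) :
    ∃ s : Finset (C × C), twComul k p c = ∑ x ∈ s, x.1 ⊗ₜ[k] x.2 :=
  TensorProduct.exists_finset _

theorem twComul_map (p : Bool) (f : C →ₗc[k] D) (c : C) :
    twComul k p (f c) = TensorProduct.map (f : C →ₗ[k] D) (f : C →ₗ[k] D) (twComul k p c) := by
  cases p
  · exact (CoalgHomClass.map_comp_comul_apply f c).symm
  · rw [twComul_true_apply, twComul_true_apply, TensorProduct.map_comm]
    exact congrArg _ (CoalgHomClass.map_comp_comul_apply f c).symm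

theorem twComul_tmul (p : Bool) (x : C) (y : D) :
    twComul k p (x ⊗ₜ[k] y) =
      TensorProduct.tensorTensorTensorComm k C C D D (twComul k p x ⊗ₜ twComul k p y) := by
  cases p
  · rfl
  · simp only [twComul_true_apply, TensorProduct.comul_tmul]
    generalize comul (R := k) x = t
    generalize comul (R := k) y = t'
    induction t with
    | zero => simp
    | add a b ha hb => simp only [TensorProduct.add_tmul, map_add, ha, hb]
    | tmul a b =>
      induction t' with
      | zero => simp
      | add c d hc hd => simp only [TensorProduct.tmul_add, map_add, hc, hd]
      | tmul c d => rfl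

theorem twComul_tmul_eq_sum {p : Bool} {x : C} {y : D} {s : Finset (C × C)} {t : Finset (D × D)}
    (hs : twComul k p x = ∑ x ∈ s, x.1 ⊗ₜ[k] x.2) (ht : twComul k p y = ∑ x ∈ t, x.1 ⊗ₜ[k] x.2) :
    twComul k p (x ⊗ₜ[k] y) =
      ∑ a ∈ s, ∑ b ∈ t, (a.1 ⊗ₜ[k] b.1) ⊗ₜ[k] (a.2 ⊗ₜ[k] b.2) := by
  rw [twComul_tmul, hs, ht, TensorProduct.sum_tmul, map_sum]
  simp only [TensorProduct.tmul_sum, map_sum, TensorProduct.tensorTensorTensorComm_tmul]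

end TwistedComul

/-! ### Families of measurings linked by convolution inverses -/

section MultiMeasuring

variable {k : Type*} [Field k] {A : Type*} [Ring A] [Algebra k A] {ι : Type*}

/-- A family `β i` of actions of a coalgebra `C` on an algebra. The action `β i` is a measuring of
`C` or of the co-opposite coalgebra of `C`, according to the parity `p i`. It preserves the
functionals in `T` and fixes the elements of `S`. If `r i j`, then `β j` is the convolution inverse
of `β i`. -/
structure IsMultiMeasuring (p : ι → Bool) (r : ι → ι → Prop) (T : Set (A →ₗ[k] k)) (S : Set A)
    {C : Type*} [AddCommGroup C] [Module k C] [Coalgebra k C]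
    (β : ι → C →ₗ[k] Module.End k A) : Prop where
  act_mul : ∀ (i : ι) (a b : A) (c : C), β i c (a * b) =
    LinearMap.mul' k A
      (TensorProduct.map ((β i).flip a) ((β i).flip b) (twComul k (p i) c))
  act_one : ∀ (i : ι) (c : C), β i c 1 = algebraMap k A (counit (R := k) c)
  functional : ∀ t ∈ T, ∀ (i : ι) (a : A) (c : C), t (β i c a) = counit (R := k) c * t a
  fixes : ∀ a ∈ S, ∀ (i : ι) (c : C), β i c a = counit (R := k) c • a
  mul_inv : ∀ i j, r i j → ∀ c : C,
    LinearMap.mul' k (Module.End k A) (TensorProduct.map (β i) (β j) (twComul k (p i) c)) =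
      algebraMap k _ (counit (R := k) c)
  inv_mul : ∀ i j, r i j → ∀ c : C,
    LinearMap.mul' k (Module.End k A) (TensorProduct.map (β j) (β i) (twComul k (p i) c)) =
      algebraMap k _ (counit (R := k) c)

variable {p : ι → Bool} {r : ι → ι → Prop} {T : Set (A →ₗ[k] k)} {S : Set A}
variable {C D : Type*} [AddCommGroup C] [Module k C] [Coalgebra k C]
  [AddCommGroup D] [Module k D] [Coalgebra k D]

theorem linearMap_ext_of_iSup_range {J : Type*} {C : J → Type*} {D X : Type*}
    [∀ j, AddCommGroup (C j)] [∀ j, Module k (C j)] [AddCommGroup D] [Module k D]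
    [AddCommGroup X] [Module k X] {f : ∀ j, C j →ₗ[k] D}
    (hf : (⨆ j, LinearMap.range (f j)) = ⊤) {L L' : D →ₗ[k] X}
    (h : ∀ j c, L (f j c) = L' (f j c)) : L = L' := by
  have : LinearMap.eqLocus L L' = ⊤ := by
    rw [eq_top_iff, ← hf, iSup_le_iff]
    rintro j _ ⟨c, rfl⟩
    exact h j c
  ext d
  exact (this ▸ Submodule.mem_top : d ∈ LinearMap.eqLocus L L')

/-- Each axiom is an equality of two linear maps on `D` built from the counit, the twisted
comultiplication and the actions. All of these are compatible with coalgebra maps, so the equality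
may be checked on the ranges. -/
theorem IsMultiMeasuring.of_iSup_range {J : Type*} {C : J → Type*} [∀ j, AddCommGroup (C j)]
    [∀ j, Module k (C j)] [∀ j, Coalgebra k (C j)] {f : ∀ j, C j →ₗc[k] D}
    {β : ι → D →ₗ[k] Module.End k A}
    (h : ∀ j, IsMultiMeasuring p r T S (fun i => β i ∘ₗ (f j : C j →ₗ[k] D)))
    (hf : (⨆ j, LinearMap.range (f j : C j →ₗ[k] D)) = ⊤) : IsMultiMeasuring p r T S β where
  act_mul i a b := LinearMap.congr_fun <| linearMap_ext_of_iSup_range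
      (L := (β i).flip (a * b))
      (L' := LinearMap.mul' k A ∘ₗ TensorProduct.map ((β i).flip a) ((β i).flip b) ∘ₗ
        twComul k (p i)) hf fun j c => by
    have := (h j).act_mul i a b c
    simp only [LinearMap.comp_apply, CoalgHom.coe_toLinearMap, twComul_map] at this ⊢
    rw [TensorProduct.map_map]
    exact this
  act_one i := LinearMap.congr_fun <| linearMap_ext_of_iSup_range
      (L := (β i).flip 1) (L' := Algebra.linearMap k A ∘ₗ counit) hf fun j c => by
    have := (h j).act_one i c
    simpa using this
  functional t ht i a := LinearMap.congr_fun <| linearMap_ext_of_iSup_range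
      (L := t ∘ₗ (β i).flip a) (L' := LinearMap.mulRight k (t a) ∘ₗ counit) hf fun j c => by
    have := (h j).functional t ht i a c
    simpa using this
  fixes a ha i := LinearMap.congr_fun <| linearMap_ext_of_iSup_range
      (L := (β i).flip a) (L' := LinearMap.toSpanSingleton k A a ∘ₗ counit) hf fun j c => by
    have := (h j).fixes a ha i c
    simpa using this
  mul_inv i i' hr := LinearMap.congr_fun <| linearMap_ext_of_iSup_range
      (L := LinearMap.mul' k (Module.End k A) ∘ₗ TensorProduct.map (β i) (β i') ∘ₗ
        twComul k (p i))
      (L' := Algebra.linearMap k (Module.End k A) ∘ₗ counit) hf fun j c => by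
    have := (h j).mul_inv i i' hr c
    simp only [LinearMap.comp_apply, CoalgHom.coe_toLinearMap, twComul_map,
      CoalgHomClass.counit_comp_apply] at this ⊢
    rw [TensorProduct.map_map]
    exact this
  inv_mul i i' hr := LinearMap.congr_fun <| linearMap_ext_of_iSup_range
      (L := LinearMap.mul' k (Module.End k A) ∘ₗ TensorProduct.map (β i') (β i) ∘ₗ
        twComul k (p i))
      (L' := Algebra.linearMap k (Module.End k A) ∘ₗ counit) hf fun j c => by
    have := (h j).inv_mul i i' hr c
    simp only [LinearMap.comp_apply, CoalgHom.coe_toLinearMap, twComul_map,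
      CoalgHomClass.counit_comp_apply] at this ⊢
    rw [TensorProduct.map_map]
    exact this

theorem IsMultiMeasuring.act_mul_eq_sum {β : ι → C →ₗ[k] Module.End k A}
    (h : IsMultiMeasuring p r T S β) (i : ι) {c : C} {s : Finset (C × C)}
    (hs : twComul k (p i) c = ∑ x ∈ s, x.1 ⊗ₜ[k] x.2) (a b : A) :
    β i c (a * b) = ∑ x ∈ s, β i x.1 a * β i x.2 b := by
  rw [h.act_mul, hs]
  simp

theorem IsMultiMeasuring.mul_inv_eq_sum {β : ι → C →ₗ[k] Module.End k A}
    (h : IsMultiMeasuring p r T S β) {i j : ι} (hr : r i j) {c : C} {s : Finset (C × C)}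
    (hs : twComul k (p i) c = ∑ x ∈ s, x.1 ⊗ₜ[k] x.2) :
    ∑ x ∈ s, β i x.1 * β j x.2 = algebraMap k _ (counit (R := k) c) := by
  rw [← h.mul_inv i j hr, hs]
  simp

theorem IsMultiMeasuring.inv_mul_eq_sum {β : ι → C →ₗ[k] Module.End k A}
    (h : IsMultiMeasuring p r T S β) {i j : ι} (hr : r i j) {c : C} {s : Finset (C × C)}
    (hs : twComul k (p i) c = ∑ x ∈ s, x.1 ⊗ₜ[k] x.2) :
    ∑ x ∈ s, β j x.1 * β i x.2 = algebraMap k _ (counit (R := k) c) := by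
  rw [← h.inv_mul i j hr, hs]
  simp

/-- The inner pair collapses to a scalar, which is central and moves out, leaving the outer pair. -/
theorem sum_mul_nested {E X Y : Type*} [Ring E] [Algebra k E] (s : Finset X) (t : Finset Y)
    (f f' : X → E) (g g' : Y → E) {a b : k} (hs : ∑ x ∈ s, f x * f' x = algebraMap k E a)
    (ht : ∑ y ∈ t, g y * g' y = algebraMap k E b) :
    ∑ x ∈ s, ∑ y ∈ t, f x * g y * (g' y * f' x) = algebraMap k E (b * a) := by
  calc ∑ x ∈ s, ∑ y ∈ t, f x * g y * (g' y * f' x)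
      = ∑ x ∈ s, f x * (∑ y ∈ t, g y * g' y) * f' x := by
        simp only [Finset.mul_sum, Finset.sum_mul, mul_assoc]
    _ = algebraMap k E b * ∑ x ∈ s, f x * f' x := by
        rw [ht, Finset.mul_sum]
        exact Finset.sum_congr rfl fun x _ => by rw [← Algebra.commutes, mul_assoc]
    _ = _ := by rw [hs, map_mul]

/-- Measurings compose. The inverse of a composite is the composite of the inverses in reverse
order, which is why related indices must have opposite parity and why `tensorAct` switches the order
with parity. -/
theorem IsMultiMeasuring.tensor (hp : ∀ i j, r i j → p j = !p i)
    {β : ι → C →ₗ[k] Module.End k A} {γ : ι → D →ₗ[k] Module.End k A}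
    (hβ : IsMultiMeasuring p r T S β) (hγ : IsMultiMeasuring p r T S γ) :
    IsMultiMeasuring p r T S (fun i => tensorAct (p i) (β i) (γ i)) where
  act_mul i a b := linearMap_tensor_ext
      (L := (tensorAct (p i) (β i) (γ i)).flip (a * b))
      (L' := LinearMap.mul' k A ∘ₗ TensorProduct.map ((tensorAct (p i) (β i) (γ i)).flip a)
        ((tensorAct (p i) (β i) (γ i)).flip b) ∘ₗ twComul k (p i)) fun x y => by
    obtain ⟨s, hs⟩ := exists_twComul_eq_sum (k := k) (p i) x
    obtain ⟨t, ht⟩ := exists_twComul_eq_sum (k := k) (p i) y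
    have h1 := hβ.act_mul_eq_sum i hs
    have h2 := hγ.act_mul_eq_sum i ht
    simp only [LinearMap.comp_apply, twComul_tmul_eq_sum hs ht, map_sum, TensorProduct.map_tmul,
      LinearMap.flip_apply, tensorAct_tmul, LinearMap.mul'_apply]
    cases p i
    · simp only [cond_false, Module.End.mul_apply, h2, map_sum, h1]
      exact Finset.sum_comm
    · simp only [cond_true, Module.End.mul_apply, h2, map_sum, h1]
  act_one i := linearMap_tensor_ext (L := (tensorAct (p i) (β i) (γ i)).flip 1)
      (L' := Algebra.linearMap k A ∘ₗ counit) fun x y => by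
    simp only [LinearMap.comp_apply, LinearMap.flip_apply, tensorAct_tmul,
      TensorProduct.counit_tmul, Algebra.linearMap_apply]
    cases p i <;>
    simp [hβ.act_one, hγ.act_one, Algebra.algebraMap_eq_smul_one, smul_smul, mul_comm]
  functional τ hτ i a := linearMap_tensor_ext (L := τ ∘ₗ (tensorAct (p i) (β i) (γ i)).flip a)
      (L' := LinearMap.mulRight k (τ a) ∘ₗ counit) fun x y => by
    simp only [LinearMap.comp_apply, LinearMap.flip_apply, tensorAct_tmul,
      TensorProduct.counit_tmul, LinearMap.mulRight_apply]
    cases p i <;>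
    simp [hβ.functional τ hτ, hγ.functional τ hτ, mul_comm, mul_left_comm, mul_assoc]
  fixes a ha i := linearMap_tensor_ext (L := (tensorAct (p i) (β i) (γ i)).flip a)
      (L' := LinearMap.toSpanSingleton k A a ∘ₗ counit) fun x y => by
    simp only [LinearMap.comp_apply, LinearMap.flip_apply, tensorAct_tmul,
      TensorProduct.counit_tmul, LinearMap.toSpanSingleton_apply]
    cases p i <;>
    simp [hβ.fixes a ha, hγ.fixes a ha, smul_smul, mul_comm]
  mul_inv i j hr := linearMap_tensor_ext
      (L := LinearMap.mul' k (Module.End k A) ∘ₗ TensorProduct.map (tensorAct (p i) (β i) (γ i))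
        (tensorAct (p j) (β j) (γ j)) ∘ₗ twComul k (p i))
      (L' := Algebra.linearMap k (Module.End k A) ∘ₗ counit) fun x y => by
    obtain ⟨s, hs⟩ := exists_twComul_eq_sum (k := k) (p i) x
    obtain ⟨t, ht⟩ := exists_twComul_eq_sum (k := k) (p i) y
    have h1 := hβ.mul_inv_eq_sum hr hs
    have h2 := hγ.mul_inv_eq_sum hr ht
    simp only [LinearMap.comp_apply, twComul_tmul_eq_sum hs ht, map_sum, TensorProduct.map_tmul,
      tensorAct_tmul, LinearMap.mul'_apply, hp i j hr, TensorProduct.counit_tmul,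
      Algebra.linearMap_apply]
    -- The `γ` pair is the inner one for even parity, the `β` pair for odd parity.
    cases p i
    · exact sum_mul_nested s t _ _ _ _ h1 h2
    · rw [Finset.sum_comm, smul_eq_mul, mul_comm]
      exact sum_mul_nested t s _ _ _ _ h2 h1
  inv_mul i j hr := linearMap_tensor_ext
      (L := LinearMap.mul' k (Module.End k A) ∘ₗ TensorProduct.map (tensorAct (p j) (β j) (γ j))
        (tensorAct (p i) (β i) (γ i)) ∘ₗ twComul k (p i))
      (L' := Algebra.linearMap k (Module.End k A) ∘ₗ counit) fun x y => by
    obtain ⟨s, hs⟩ := exists_twComul_eq_sum (k := k) (p i) x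
    obtain ⟨t, ht⟩ := exists_twComul_eq_sum (k := k) (p i) y
    have h1 := hβ.inv_mul_eq_sum hr hs
    have h2 := hγ.inv_mul_eq_sum hr ht
    simp only [LinearMap.comp_apply, twComul_tmul_eq_sum hs ht, map_sum, TensorProduct.map_tmul,
      tensorAct_tmul, LinearMap.mul'_apply, hp i j hr, TensorProduct.counit_tmul,
      Algebra.linearMap_apply]
    cases p i
    · rw [Finset.sum_comm, smul_eq_mul, mul_comm]
      exact sum_mul_nested t s _ _ _ _ h2 h1
    · exact sum_mul_nested s t _ _ _ _ h1 h2

end MultiMeasuring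

/-! ### Universal families and coinduction -/

section Universal

variable {k : Type u} [Field k] {A : Type v} [Ring A] [Algebra k A] {ι : Type}

/-- A terminal object among the coalgebras with a family of actions as in `IsMultiMeasuring`. -/
def IsUniversalFamily (p : ι → Bool) (r : ι → ι → Prop) (T : Set (A →ₗ[k] k)) (S : Set A)
    {M : Type (max u v)} [AddCommGroup M] [Module k M] [Coalgebra k M]
    (β : ι → M →ₗ[k] Module.End k A) : Prop :=
  IsMultiMeasuring p r T S β ∧
    ∀ (C : Type (max u v)) [AddCommGroup C] [Module k C] [Coalgebra k C]
      (γ : ι → C →ₗ[k] Module.End k A), IsMultiMeasuring p r T S γ →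
      ∃! f : C →ₗc[k] M, ∀ i c, β i (f c) = γ i c

variable {p : ι → Bool} {r : ι → ι → Prop} {T : Set (A →ₗ[k] k)} {S : Set A}

theorem isLocalProperty_isMultiMeasuring (p : ι → Bool) (r : ι → ι → Prop)
    (T : Set (A →ₗ[k] k)) (S : Set A) :
    IsLocalProperty.{u, v} (k := k) (V := ι → Module.End k A)
      (fun _ _ _ _ β => IsMultiMeasuring p r T S (fun i => LinearMap.proj i ∘ₗ β)) :=
  fun _ _ _ _ _ _ _ _ _ _ _ h hf => IsMultiMeasuring.of_iSup_range h hf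

/-- A family of actions is a single linear map to the product `ι → Module.End k A`, so the general
existence theorem applies. -/
theorem isTerminalOver_iff {M : Type (max u v)} [AddCommGroup M] [Module k M] [Coalgebra k M]
    {β : M →ₗ[k] ι → Module.End k A} :
    IsTerminalOver.{u, v} (k := k) (V := ι → Module.End k A)
      (fun _ _ _ _ β => IsMultiMeasuring p r T S (fun i => LinearMap.proj i ∘ₗ β)) β ↔
    IsUniversalFamily p r T S (fun i => LinearMap.proj i ∘ₗ β) := by
  refine and_congr Iff.rfl ⟨fun h C _ _ _ γ hγ => ?_, fun h C _ _ _ γ hγ => ?_⟩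
  · obtain ⟨f, hf, hf'⟩ := h C (LinearMap.pi γ) hγ
    refine ⟨f, fun i c => congrFun (LinearMap.congr_fun hf c) i, fun g hg => hf' g ?_⟩
    ext1 c
    funext i
    exact hg i c
  · obtain ⟨f, hf, hf'⟩ := h C _ hγ
    refine ⟨f, ?_, fun g hg => hf' g fun i c => congrFun (LinearMap.congr_fun hg c) i⟩
    ext1 c
    funext i
    exact hf i c

theorem exists_isUniversalFamily (p : ι → Bool) (r : ι → ι → Prop)
    (T : Set (A →ₗ[k] k)) (S : Set A) :
    ∃ (M : Type (max u v)) (_ : AddCommGroup M) (_ : Module k M) (_ : Coalgebra k M)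
      (β : ι → M →ₗ[k] Module.End k A), IsUniversalFamily p r T S β := by
  obtain ⟨M, _, _, _, β, hβ⟩ :=
    (isLocalProperty_isMultiMeasuring p r T S).exists_isTerminalOver
  exact ⟨M, _, _, _, _, isTerminalOver_iff.1 hβ⟩

variable {M : Type (max u v)} [AddCommGroup M] [Module k M] [Coalgebra k M]
  {β : ι → M →ₗ[k] Module.End k A}

theorem IsUniversalFamily.eq_bot_of_isCoideal (hβ : IsUniversalFamily p r T S β)
    (J : Submodule k M) (hJ : J.IsCoideal) (h : ∀ i, J ≤ LinearMap.ker (β i)) : J = ⊥ := by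
  refine IsTerminalOver.injective_of_ker (isLocalProperty_isMultiMeasuring p r T S)
    (β := LinearMap.pi β) (isTerminalOver_iff.2 hβ) J hJ fun x hx => ?_
  ext1 i
  exact h i hx

theorem span_range_sub_le_ker {k M X Y : Type*} [Field k] [AddCommGroup M] [Module k M] [AddCommGroup X] [Module k X] {f g : Y → M}
    (L : M →ₗ[k] X) (h : ∀ y, L (f y) = L (g y)) :
    Submodule.span k (Set.range fun y => f y - g y) ≤ LinearMap.ker L := by
  rw [Submodule.span_le]
  rintro _ ⟨y, rfl⟩
  simp [h]

/-- Coinduction: two parametrized families of elements of a universal coalgebra agree if they have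
the same counits and actions, and if any linear map that identifies them also identifies their
comultiplications. -/
theorem IsUniversalFamily.coinduction (hβ : IsUniversalFamily p r T S β) {Y : Type*}
    (f g : Y → M) (hε : ∀ y, counit (R := k) (f y) = counit (R := k) (g y))
    (hact : ∀ i y, β i (f y) = β i (g y))
    (hΔ : ∀ (X : Type (max u v)) [AddCommGroup X] [Module k X] (q : M →ₗ[k] X),
      (∀ y, q (f y) = q (g y)) →
      ∀ y, TensorProduct.map q q (comul (R := k) (f y)) =
        TensorProduct.map q q (comul (R := k) (g y))) (y : Y) : f y = g y := by
  -- The hypotheses say exactly that `J` is a coideal killed by all actions: `hε` gives the counit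
  -- condition, and `hΔ` at `q = J.mkQ` the comultiplication condition.
  let J : Submodule k M := Submodule.span k (Set.range fun y => f y - g y)
  have hmem (y : Y) : f y - g y ∈ J := Submodule.subset_span ⟨y, rfl⟩
  have hq (y : Y) : J.mkQ (f y) = J.mkQ (g y) := (Submodule.Quotient.eq J).2 (hmem y)
  have hJ : J = ⊥ := hβ.eq_bot_of_isCoideal J
    ⟨fun x hx => LinearMap.mem_ker.1 (span_range_sub_le_ker counit hε hx), fun x hx =>
      span_range_sub_le_ker (TensorProduct.map J.mkQ J.mkQ ∘ₗ comul) (hΔ _ J.mkQ hq) hx⟩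
    fun i => span_range_sub_le_ker (β i) (hact i)
  have := hmem y
  rw [hJ, Submodule.mem_bot] at this
  exact sub_eq_zero.1 this

end Universal

/-! ### Bialgebras from multiplications that are coalgebra maps -/

section BialgebraOfCoalgHom

variable {k : Type*} [Field k]

/-- The ring structure on a vector space given by a linear map `M ⊗ M → M`. -/
@[reducible]
noncomputable def ringOfMul {M : Type*} [AddCommGroup M] [Module k M] (μ : M ⊗[k] M →ₗ[k] M) (e : M)
    (hassoc : ∀ x y z, μ (μ (x ⊗ₜ y) ⊗ₜ z) = μ (x ⊗ₜ μ (y ⊗ₜ z)))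
    (hone_mul : ∀ x, μ (e ⊗ₜ x) = x) (hmul_one : ∀ x, μ (x ⊗ₜ e) = x) : Ring M :=
  { (inferInstance : AddCommGroup M) with
    mul := fun x y => μ (x ⊗ₜ y)
    one := e
    left_distrib := fun x y z => by
      change μ (x ⊗ₜ (y + z)) = μ (x ⊗ₜ y) + μ (x ⊗ₜ z)
      rw [TensorProduct.tmul_add, map_add]
    right_distrib := fun x y z => by
      change μ ((x + y) ⊗ₜ z) = μ (x ⊗ₜ z) + μ (y ⊗ₜ z)
      rw [TensorProduct.add_tmul, map_add]
    zero_mul := fun x => by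
      change μ (0 ⊗ₜ x) = 0
      rw [TensorProduct.zero_tmul, map_zero]
    mul_zero := fun x => by
      change μ (x ⊗ₜ 0) = 0
      rw [TensorProduct.tmul_zero, map_zero]
    mul_assoc := hassoc
    one_mul := hone_mul
    mul_one := hmul_one }

/-- The bialgebra is `M` itself. Quantifying over a new type `B` with an equivalence to `M` keeps
the ring structure apart from the given additive one. -/
theorem exists_bialgebra_of_coalgHom {M : Type v} [AddCommGroup M] [Module k M] [Coalgebra k M]
    (μ : M ⊗[k] M →ₗc[k] M) (e : M)
    (hassoc : ∀ x y z, μ (μ (x ⊗ₜ y) ⊗ₜ z) = μ (x ⊗ₜ μ (y ⊗ₜ z)))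
    (hone_mul : ∀ x, μ (e ⊗ₜ x) = x) (hmul_one : ∀ x, μ (x ⊗ₜ e) = x)
    (hcounit : counit (R := k) e = 1) (hcomul : comul (R := k) e = e ⊗ₜ e) :
    ∃ (B : Type v) (_ : Ring B) (_ : Bialgebra k B) (E : B ≃ₗc[k] M),
      (∀ x y, E (x * y) = μ (E x ⊗ₜ E y)) ∧ E 1 = e := by
  have hΔ (x y : M) (s t : Finset (M × M)) (hs : comul (R := k) x = ∑ a ∈ s, a.1 ⊗ₜ a.2)
      (ht : comul (R := k) y = ∑ b ∈ t, b.1 ⊗ₜ b.2) : comul (R := k) (μ (x ⊗ₜ y)) =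
      ∑ a ∈ s, ∑ b ∈ t, μ (a.1 ⊗ₜ b.1) ⊗ₜ[k] μ (a.2 ⊗ₜ b.2) := by
    rw [← CoalgHomClass.map_comp_comul_apply, ← twComul_false,
      twComul_tmul_eq_sum (p := false) hs ht]
    simp
  let R : Ring M := ringOfMul (μ : M ⊗[k] M →ₗ[k] M) e hassoc hone_mul hmul_one
  have hmul (x y : M) : x * y = μ (x ⊗ₜ y) := rfl
  -- Built on the given scalar multiplication, so that the existing comultiplication and counit stay
  -- linear for the new algebra.
  let _ : Algebra k M := Algebra.ofModule
    (fun r x y => by rw [hmul, hmul, ← TensorProduct.smul_tmul', map_smul])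
    (fun r x y => by rw [hmul, hmul, TensorProduct.tmul_smul, map_smul])
  let _ : Bialgebra k M := Bialgebra.mk' k M hcounit
    (fun {x y} => by
      rw [hmul, CoalgHomClass.counit_comp_apply, TensorProduct.counit_tmul, smul_eq_mul, mul_comm])
    hcomul
    (fun {x y} => by
      rw [hmul]
      obtain ⟨s, hs⟩ := exists_twComul_eq_sum (k := k) false x
      obtain ⟨t, ht⟩ := exists_twComul_eq_sum (k := k) false y
      refine (hΔ x y s t hs ht).trans ?_
      rw [twComul_false] at hs ht
      conv_rhs => rw [hs, ht, Finset.sum_mul_sum]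
      refine Finset.sum_congr rfl fun a _ => Finset.sum_congr rfl fun b _ => ?_
      exact (Algebra.TensorProduct.tmul_mul_tmul a.1 b.1 a.2 b.2).symm)
  exact ⟨M, R, inferInstance, CoalgEquiv.refl k M, fun _ _ => rfl, rfl⟩

end BialgebraOfCoalgHom

/-! ### Universal families as universal modules over a bialgebra -/

section UniversalBialgebra

variable {k : Type u} [Field k] {A : Type v} [Ring A] [Algebra k A] {ι : Type}
variable {p : ι → Bool} {r : ι → ι → Prop} {T : Set (A →ₗ[k] k)} {S : Set A}

section

variable {M : Type (max u v)} [AddCommGroup M] [Module k M] [Coalgebra k M]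
  {β : ι → M →ₗ[k] Module.End k A}

/-- Coinduction replaces the uniqueness part of terminality, so `C` may live in any universe and
need not be known to carry a measuring. -/
theorem IsUniversalFamily.hom_ext (hβ : IsUniversalFamily p r T S β) {C : Type*} [AddCommGroup C]
    [Module k C] [Coalgebra k C] {f g : C →ₗc[k] M} (h : ∀ i c, β i (f c) = β i (g c)) :
    f = g := by
  ext c
  refine hβ.coinduction f g (fun c => by simp) h (fun X _ _ q hq c => ?_) c
  rw [← CoalgHomClass.map_comp_comul_apply, ← CoalgHomClass.map_comp_comul_apply,
    TensorProduct.map_map, TensorProduct.map_map]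
  congr 2 <;> exact LinearMap.ext hq

theorem IsUniversalFamily.of_equiv (hβ : IsUniversalFamily p r T S β) {N : Type (max u v)}
    [AddCommGroup N] [Module k N] [Coalgebra k N] (e : N ≃ₗc[k] M) :
    IsUniversalFamily p r T S (fun i => β i ∘ₗ (e : N →ₗ[k] M)) := by
  refine ⟨(isLocalProperty_isMultiMeasuring p r T S).of_surjective
    (β := LinearMap.pi fun i => β i ∘ₗ (e : N →ₗ[k] M)) (e.symm : M →ₗc[k] N) e.symm.surjective ?_,
    fun C _ _ _ γ hγ => ?_⟩
  · convert hβ.1 using 2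
    ext1 m
    simp
  · obtain ⟨f, hf, hf'⟩ := hβ.2 C γ hγ
    refine ⟨(e.symm : M →ₗc[k] N).comp f, fun i c => by simp [hf], fun g hg => ?_⟩
    rw [← hf' ((e : N →ₗc[k] M).comp g) hg]
    ext c
    simp

/-- The one-dimensional coalgebra acts by scalars. -/
theorem isMultiMeasuring_unit (p : ι → Bool) (r : ι → ι → Prop) (T : Set (A →ₗ[k] k)) (S : Set A)
    (X : Type*) : IsMultiMeasuring p r T S
      (fun _ => Algebra.linearMap k (Module.End k A) ∘ₗ counit (A := X →₀ k)) := by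
  have htw (b : Bool) (x : X) : twComul k b (Finsupp.single x (1 : k)) =
      Finsupp.single x (1 : k) ⊗ₜ Finsupp.single x (1 : k) := by
    cases b <;> simp [twComul_true_apply]
  have key {Y : Type _} [AddCommGroup Y] [Module k Y] {L L' : (X →₀ k) →ₗ[k] Y}
      (h : ∀ x, L (Finsupp.single x 1) = L' (Finsupp.single x 1)) (c : X →₀ k) : L c = L' c :=
    LinearMap.congr_fun (Finsupp.lhom_ext' fun x => LinearMap.ext_ring (h x)) c
  have key' {L L' : (X →₀ k) →ₗ[k] k}
      (h : ∀ x, L (Finsupp.single x 1) = L' (Finsupp.single x 1)) (c : X →₀ k) : L c = L' c :=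
    LinearMap.congr_fun (Finsupp.lhom_ext' fun x => LinearMap.ext_ring (h x)) c
  set γ : (X →₀ k) →ₗ[k] Module.End k A := Algebra.linearMap k (Module.End k A) ∘ₗ counit with hγ
  have hγ1 (x : X) : γ (Finsupp.single x 1) = 1 := by simp [hγ]
  refine ⟨fun i a b => key (L := γ.flip (a * b)) (L' := LinearMap.mul' k A ∘ₗ
      TensorProduct.map (γ.flip a) (γ.flip b) ∘ₗ twComul k (p i)) fun x => ?_,
    fun i c => ?_, fun t ht i a c => ?_, fun a ha i c => ?_,
    fun i j _ => key (L := LinearMap.mul' k (Module.End k A) ∘ₗ TensorProduct.map γ γ ∘ₗ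
        twComul k (p i)) (L' := γ) fun x => ?_,
    fun i j _ => key (L := LinearMap.mul' k (Module.End k A) ∘ₗ TensorProduct.map γ γ ∘ₗ
        twComul k (p i)) (L' := γ) fun x => ?_⟩
  · simp [htw, hγ1]
  · simp [hγ, Algebra.algebraMap_eq_smul_one]
  · simp [hγ]
  · simp [hγ]
  · simp [htw, hγ1]
  · simp [htw, hγ1]

theorem IsUniversalFamily.exists_one (hβ : IsUniversalFamily p r T S β) :
    ∃ e : M, counit (R := k) e = 1 ∧ comul (R := k) e = e ⊗ₜ e ∧ ∀ i, β i e = 1 := by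
  -- Functions on a point stand in for `k`, which lies in `Type u`, whereas universality is tested
  -- in `Type (max u v)`.
  obtain ⟨f, hf, -⟩ := hβ.2 (PUnit.{max u v + 1} →₀ k) _
    (isMultiMeasuring_unit p r T S PUnit.{max u v + 1})
  refine ⟨f (Finsupp.single PUnit.unit 1), ?_, ?_, fun i => ?_⟩
  · simp
  · rw [← CoalgHomClass.map_comp_comul_apply]
    simp
  · simp [hf]

/-- A universal coalgebra is a bialgebra. -/
theorem IsUniversalFamily.exists_bialgebra (hβ : IsUniversalFamily p r T S β)
    (hp : ∀ i j, r i j → p j = !p i) :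
    ∃ (B : Type (max u v)) (_ : Ring B) (_ : Bialgebra k B) (e : B ≃ₗc[k] M),
      (∀ i x y, β i (e (x * y)) =
        bif p i then β i (e y) * β i (e x) else β i (e x) * β i (e y)) ∧
      ∀ i, β i (e 1) = 1 := by
  -- The product is the map that terminality assigns to the composite action. The ring laws then
  -- reduce, through `hom_ext`, to those of composition in `Module.End k A`.
  obtain ⟨μ, hμ, -⟩ := hβ.2 (M ⊗[k] M) _ (hβ.1.tensor hp hβ.1)
  obtain ⟨u, hu1, hu2, hu3⟩ := hβ.exists_one
  have hμ' (i : ι) (x y : M) : β i (μ (x ⊗ₜ y)) = bif p i then β i y * β i x else β i x * β i y := by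
    rw [hμ, tensorAct_tmul]
  -- With the unit written as a coalgebra map, the unit laws become equalities of coalgebra maps.
  let η : k →ₗc[k] M :=
    { LinearMap.toSpanSingleton k M u with
      counit_comp := by ext; simp [hu1]
      map_comp_comul := by ext; simp [hu2] }
  have hη : η 1 = u := one_smul k u
  have hassoc : μ.comp (Coalgebra.TensorProduct.map μ (CoalgHom.id k M)) =
      μ.comp ((Coalgebra.TensorProduct.map (CoalgHom.id k M) μ).comp
        (Coalgebra.TensorProduct.assoc k k M M M : (M ⊗[k] M) ⊗[k] M →ₗc[k] M ⊗[k] (M ⊗[k] M))) := by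
    refine hβ.hom_ext fun i c => ?_
    refine LinearMap.congr_fun (f := β i ∘ₗ ((μ.comp (Coalgebra.TensorProduct.map μ
      (CoalgHom.id k M)) : (M ⊗[k] M) ⊗[k] M →ₗc[k] M) : (M ⊗[k] M) ⊗[k] M →ₗ[k] M))
      (g := β i ∘ₗ ((μ.comp ((Coalgebra.TensorProduct.map (CoalgHom.id k M) μ).comp
        (Coalgebra.TensorProduct.assoc k k M M M : (M ⊗[k] M) ⊗[k] M →ₗc[k] M ⊗[k] (M ⊗[k] M))) :
        (M ⊗[k] M) ⊗[k] M →ₗc[k] M) : (M ⊗[k] M) ⊗[k] M →ₗ[k] M))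
      (TensorProduct.ext_threefold fun x y z => ?_) c
    change β i (μ (μ (x ⊗ₜ y) ⊗ₜ z)) = β i (μ (x ⊗ₜ μ (y ⊗ₜ z)))
    simp only [hμ']
    cases p i <;> simp [mul_assoc]
  have hone_mul : μ.comp ((Coalgebra.TensorProduct.map η (CoalgHom.id k M)).comp
      ((Coalgebra.TensorProduct.lid k M).symm : M →ₗc[k] k ⊗[k] M)) = CoalgHom.id k M := by
    refine hβ.hom_ext fun i x => ?_
    change β i (μ (η 1 ⊗ₜ x)) = β i x
    rw [hμ', hη, hu3]
    cases p i <;> simp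
  have hmul_one : μ.comp ((Coalgebra.TensorProduct.map (CoalgHom.id k M) η).comp
      ((Coalgebra.TensorProduct.rid k k M).symm : M →ₗc[k] M ⊗[k] k)) = CoalgHom.id k M := by
    refine hβ.hom_ext fun i x => ?_
    change β i (μ (x ⊗ₜ η 1)) = β i x
    rw [hμ', hη, hu3]
    cases p i <;> simp
  obtain ⟨B, _, _, e, he, he1⟩ := exists_bialgebra_of_coalgHom μ u
    (fun x y z => DFunLike.congr_fun hassoc ((x ⊗ₜ y) ⊗ₜ z))
    (fun x => by
      have : μ (η 1 ⊗ₜ x) = x := DFunLike.congr_fun hone_mul x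
      rwa [hη] at this)
    (fun x => by
      have : μ (x ⊗ₜ η 1) = x := DFunLike.congr_fun hmul_one x
      rwa [hη] at this) hu1 hu2
  exact ⟨B, _, _, e, fun i x y => by rw [he, hμ'], fun i => by rw [he1, hu3]⟩

end

/-- A universal family of actions of a bialgebra, compatible with the product. -/
structure IsUniversalModule (p : ι → Bool) (r : ι → ι → Prop) (T : Set (A →ₗ[k] k)) (S : Set A)
    {B : Type (max u v)} [Ring B] [Bialgebra k B] (β : ι → B →ₗ[k] Module.End k A) : Prop where
  universal : IsUniversalFamily p r T S β
  act_mul : ∀ i x y, β i (x * y) = bif p i then β i y * β i x else β i x * β i y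
  act_one : ∀ i, β i 1 = 1

theorem exists_isUniversalModule (p : ι → Bool) (r : ι → ι → Prop) (T : Set (A →ₗ[k] k))
    (S : Set A) (hp : ∀ i j, r i j → p j = !p i) :
    ∃ (B : Type (max u v)) (_ : Ring B) (_ : Bialgebra k B) (β : ι → B →ₗ[k] Module.End k A),
      IsUniversalModule p r T S β := by
  obtain ⟨M, _, _, _, β, hβ⟩ := exists_isUniversalFamily p r T S
  obtain ⟨B, _, _, e, hmul, hone⟩ := hβ.exists_bialgebra hp
  exact ⟨B, _, _, _, hβ.of_equiv e, hmul, hone⟩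

variable {B : Type (max u v)} [Ring B] [Bialgebra k B] {β : ι → B →ₗ[k] Module.End k A}

/-- The coalgebra map given by terminality respects unit and product by coinduction, since both
sides have equal counits and actions and comultiplication is multiplicative. -/
theorem IsUniversalModule.exists_bialgHom (hβ : IsUniversalModule p r T S β)
    {D : Type (max u v)} [Ring D] [Bialgebra k D] {γ : ι → D →ₗ[k] Module.End k A}
    (hγ : IsMultiMeasuring p r T S γ)
    (hmul : ∀ i x y, γ i (x * y) = bif p i then γ i y * γ i x else γ i x * γ i y)
    (hone : ∀ i, γ i 1 = 1) : ∃ f : D →ₐc[k] B, ∀ i d, β i (f d) = γ i d := by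
  obtain ⟨f, hf, -⟩ := hβ.universal.2 D γ hγ
  have h1 : f 1 = 1 := by
    refine hβ.universal.coinduction (fun _ : Unit => f 1) (fun _ => 1) (fun _ => by simp)
      (fun i _ => by rw [hf, hone, hβ.act_one]) (fun X _ _ q hq _ => ?_) ()
    have hq' := hq ()
    rw [← CoalgHomClass.map_comp_comul_apply, Bialgebra.comul_one, Bialgebra.comul_one,
      Algebra.TensorProduct.one_def, Algebra.TensorProduct.one_def]
    simp [hq']
  have hm (x y : D) : f (x * y) = f x * f y := by
    refine hβ.universal.coinduction (fun z : D × D => f (z.1 * z.2)) (fun z => f z.1 * f z.2)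
      (fun z => by simp)
      (fun i z => by rw [hf, hmul, hβ.act_mul, hf, hf]) (fun X _ _ q hq z => ?_) (x, y)
    rw [← CoalgHomClass.map_comp_comul_apply, Bialgebra.comul_mul, Bialgebra.comul_mul,
      ← CoalgHomClass.map_comp_comul_apply, ← CoalgHomClass.map_comp_comul_apply,
      ← (ℛ k z.1).eq, ← (ℛ k z.2).eq]
    simp [Finset.sum_mul_sum, fun x y => hq (x, y)]
  exact ⟨{ f with map_one' := h1, map_mul' := hm }, hf⟩

theorem IsUniversalModule.bialgHom_ext (hβ : IsUniversalModule p r T S β)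
    {D : Type*} [Ring D] [Bialgebra k D] {f g : D →ₐc[k] B}
    (h : ∀ i d, β i (f d) = β i (g d)) : f = g := by
  have : (f : D →ₗc[k] B) = (g : D →ₗc[k] B) := hβ.universal.hom_ext h
  ext d
  exact DFunLike.congr_fun this d

end UniversalBialgebra

/-! ### The co-opposite coalgebra -/

section CoOpposite

variable {k : Type*} [Field k] {C : Type*} [AddCommGroup C] [Module k C] [Coalgebra k C]

/-- The co-opposite of a coalgebra. -/
def CoOp (C : Type*) : Type _ := C

instance : AddCommGroup (CoOp C) := inferInstanceAs (AddCommGroup C)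

instance : Module k (CoOp C) := inferInstanceAs (Module k C)

/-- The two ways of writing the iterated opposite comultiplication agree. -/
theorem coassoc_twComul_true :
    TensorProduct.assoc k C C C ∘ₗ (twComul k true).rTensor C ∘ₗ twComul k true =
      (twComul k true).lTensor C ∘ₗ twComul k (C := C) true := by
  -- The reversal `a ⊗ (b ⊗ c) ↦ c ⊗ (b ⊗ a)`; it turns coassociativity of `comul` into that of the
  -- opposite.
  let θ : C ⊗[k] (C ⊗[k] C) →ₗ[k] C ⊗[k] (C ⊗[k] C) :=
    (TensorProduct.assoc k C C C).toLinearMap ∘ₗ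
      (TensorProduct.comm k C (C ⊗[k] C)).toLinearMap ∘ₗ
      (TensorProduct.comm k C C).toLinearMap.lTensor C
  have h1 : (TensorProduct.assoc k C C C).toLinearMap ∘ₗ (twComul k true).rTensor C ∘ₗ
      (TensorProduct.comm k C C).toLinearMap = θ ∘ₗ comul.lTensor C := by
    ext a b
    rfl
  have h2 : (twComul k true).lTensor C ∘ₗ (TensorProduct.comm k C C).toLinearMap =
      θ ∘ₗ (TensorProduct.assoc k C C C).toLinearMap ∘ₗ comul.rTensor C := by
    ext a b
    simp only [θ, TensorProduct.AlgebraTensorModule.curry_apply, TensorProduct.curry_apply,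
      LinearMap.coe_restrictScalars, LinearMap.comp_apply, LinearEquiv.coe_coe,
      TensorProduct.comm_tmul, LinearMap.lTensor_tmul, LinearMap.rTensor_tmul, twComul_true_apply]
    generalize comul (R := k) a = t
    induction t with
    | zero => simp
    | add x y hx hy => simp only [TensorProduct.add_tmul, TensorProduct.tmul_add, map_add, hx, hy]
    | tmul x y => rfl
  ext c
  have h1' := LinearMap.congr_fun h1 (comul (R := k) c)
  have h2' := LinearMap.congr_fun h2 (comul (R := k) c)
  have h3 := LinearMap.congr_fun (coassoc (R := k) (A := C)) c
  simp only [LinearMap.comp_apply] at h1' h2' h3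
  exact h1'.trans ((congrArg θ h3).symm.trans h2'.symm)

noncomputable instance : Coalgebra k (CoOp C) where
  comul := twComul k (C := C) true
  counit := counit (R := k) (A := C)
  coassoc := by
    have h := coassoc_twComul_true (k := k) (C := C)
    exact h
  rTensor_counit_comp_comul := by
    have h : LinearMap.rTensor C (counit (R := k) (A := C)) ∘ₗ
        (TensorProduct.comm k C C).toLinearMap = (TensorProduct.comm k C k).toLinearMap ∘ₗ
        LinearMap.lTensor C counit := by
      ext; rfl
    ext c
    exact (LinearMap.congr_fun h (comul (R := k) (A := C) c)).trans
      (congrArg (TensorProduct.comm k C k) (lTensor_counit_comul (A := C) c))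
  lTensor_counit_comp_comul := by
    have h : LinearMap.lTensor C (counit (R := k) (A := C)) ∘ₗ
        (TensorProduct.comm k C C).toLinearMap = (TensorProduct.comm k k C).toLinearMap ∘ₗ
        LinearMap.rTensor C counit := by
      ext; rfl
    ext c
    exact (LinearMap.congr_fun h (comul (R := k) (A := C) c)).trans
      (congrArg (TensorProduct.comm k k C) (rTensor_counit_comul (A := C) c))

theorem twComul_coOp (p : Bool) : twComul k (C := CoOp C) p = twComul k (C := C) (!p) := by
  cases p
  · rfl
  · ext c
    change TensorProduct.comm k C C (twComul k (C := C) true c) = _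
    exact comm_twComul (C := C) true c

variable {A : Type*} [Ring A] [Algebra k A] {ι : Type*}
variable {p : ι → Bool} {r : ι → ι → Prop} {T : Set (A →ₗ[k] k)} {S : Set A}

/-- A linear map, regarded as a map on the co-opposite coalgebra. -/
def coOpMap {X : Type*} [AddCommGroup X] [Module k X] (f : C →ₗ[k] X) : CoOp C →ₗ[k] X := f

/-- A parity-reversing reindexing turns a family of actions of `C` into a family of actions of the
co-opposite coalgebra. -/
theorem IsMultiMeasuring.coOp {β : ι → C →ₗ[k] Module.End k A} (h : IsMultiMeasuring p r T S β)
    {ι' : Type*} {p' : ι' → Bool} {r' : ι' → ι' → Prop} (s : ι' → ι) (hp : ∀ i, p (s i) = !p' i)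
    (hr : ∀ i j, r' i j → r (s i) (s j)) :
    IsMultiMeasuring (C := CoOp C) p' r' T S (fun i => coOpMap (β (s i))) where
  act_mul i a b c := by
    rw [twComul_coOp, ← hp]
    exact h.act_mul (s i) a b c
  act_one i c := h.act_one (s i) c
  functional t ht i a c := h.functional t ht (s i) a c
  fixes a ha i c := h.fixes a ha (s i) c
  mul_inv i j hij c := by
    rw [twComul_coOp, ← hp]
    exact h.mul_inv _ _ (hr i j hij) c
  inv_mul i j hij c := by
    rw [twComul_coOp, ← hp]
    exact h.inv_mul _ _ (hr i j hij) c

end CoOpposite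

/-! ### Sweedler identities with four factors -/

section Fourfold

variable {k : Type*} [Field k] {C X : Type*} [AddCommGroup C] [Module k C] [Coalgebra k C]
  [AddCommGroup X] [Module k X]

/-- The iterated comultiplication `c₁ ⊗ (c₂ ⊗ (c₃ ⊗ c₄))`, bracketed in two different ways. -/
theorem fourfold_comul (G : C ⊗[k] (C ⊗[k] (C ⊗[k] C)) →ₗ[k] X) (c : C) :
    G (TensorProduct.assoc k C C (C ⊗[k] C) (TensorProduct.map comul comul (comul (R := k) c))) =
      G ((TensorProduct.assoc k C C C ∘ₗ comul.rTensor C ∘ₗ comul).lTensor C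
        (comul (R := k) c)) := by
  congr 1
  have h : (TensorProduct.assoc k C C (C ⊗[k] C)).toLinearMap ∘ₗ TensorProduct.map comul comul =
      (comul.lTensor C).lTensor C ∘ₗ (TensorProduct.assoc k C C C).toLinearMap ∘ₗ
        comul.rTensor C := by
    ext a b
    simp only [TensorProduct.AlgebraTensorModule.curry_apply, TensorProduct.curry_apply,
      LinearMap.coe_restrictScalars, LinearMap.comp_apply, LinearEquiv.coe_coe,
      LinearMap.rTensor_tmul, TensorProduct.map_tmul]
    generalize comul (R := k) a = t
    induction t with
    | zero => simp
    | add x y hx hy => simp only [TensorProduct.add_tmul, map_add, hx, hy]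
    | tmul x y => simp
  have h1 := LinearMap.congr_fun h (comul (R := k) c)
  simp only [LinearMap.comp_apply, LinearEquiv.coe_coe] at h1
  rw [h1, coassoc_apply, coassoc, LinearMap.lTensor_comp, LinearMap.comp_apply]

variable {E : Type*} [Ring E] [Algebra k E]

/-- Both sides are `f₂(c₂) f₃(c₃) ⊗ f₁(c₁) f₄(c₄)`. The right side groups the adjacent factors `c₂`,
`c₃`, so the convolution of `f₂` and `f₃` appears and can be replaced by a unit when these are
inverse to each other. -/
theorem sum_map_comm_comul_mul (f₁ f₂ f₃ f₄ : C →ₗ[k] E) {c : C} {s : Finset (C × C)}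
    (hs : comul (R := k) c = ∑ x ∈ s, x.1 ⊗ₜ[k] x.2) :
    ∑ x ∈ s, TensorProduct.map f₂ f₁ (TensorProduct.comm k C C (comul (R := k) x.1)) *
        TensorProduct.map f₃ f₄ (comul (R := k) x.2) =
      ∑ x ∈ s, (1 ⊗ₜ f₁ x.1) * TensorProduct.map
        (LinearMap.mul' k E ∘ₗ TensorProduct.map f₂ f₃ ∘ₗ comul) f₄ (comul (R := k) x.2) := by
  -- `G` sends `w ⊗ x ⊗ y ⊗ z` to `f₂(x) f₃(y) ⊗ f₁(w) f₄(z)`.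
  let G : C ⊗[k] (C ⊗[k] (C ⊗[k] C)) →ₗ[k] E ⊗[k] E :=
    (LinearMap.mul' k E).lTensor E ∘ₗ (TensorProduct.leftComm k E E E).toLinearMap ∘ₗ
      ((LinearMap.mul' k E).rTensor E ∘ₗ (TensorProduct.assoc k E E E).symm.toLinearMap).lTensor E ∘ₗ
      TensorProduct.map f₁ (TensorProduct.map f₂ (TensorProduct.map f₃ f₄))
  have h1 (t t' : C ⊗[k] C) : G (TensorProduct.assoc k C C (C ⊗[k] C) (t ⊗ₜ t')) =
      TensorProduct.map f₂ f₁ (TensorProduct.comm k C C t) * TensorProduct.map f₃ f₄ t' := by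
    induction t with
    | zero => simp
    | add x y hx hy => simp only [TensorProduct.add_tmul, map_add, hx, hy, add_mul]
    | tmul w x =>
      induction t' with
      | zero => simp
      | add x y hx hy => simp only [TensorProduct.tmul_add, map_add, hx, hy, mul_add]
      | tmul y z => simp [G]
  have h2 (a : C) (t : C ⊗[k] C) :
      G (a ⊗ₜ TensorProduct.assoc k C C C (comul.rTensor C t)) =
      (1 ⊗ₜ f₁ a) * TensorProduct.map
        (LinearMap.mul' k E ∘ₗ TensorProduct.map f₂ f₃ ∘ₗ comul) f₄ t := by
    induction t with
    | zero => simp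
    | add x y hx hy => simp only [TensorProduct.tmul_add, map_add, hx, hy, mul_add]
    | tmul b b' =>
      simp only [LinearMap.rTensor_tmul, TensorProduct.map_tmul, LinearMap.comp_apply]
      generalize comul (R := k) b = t
      induction t with
      | zero => simp
      | add x y hx hy =>
        simp only [TensorProduct.tmul_add, TensorProduct.add_tmul, map_add, hx, hy, mul_add]
      | tmul y z => simp [G]
  have h := fourfold_comul G c
  rw [hs] at h
  simp only [map_sum, TensorProduct.map_tmul, h1, LinearMap.lTensor_tmul, LinearMap.comp_apply,
    LinearEquiv.coe_coe, h2] at h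
  exact h

end Fourfold

section Fourfold

variable {k : Type*} [Field k] {C : Type*} [AddCommGroup C] [Module k C] [Coalgebra k C]
variable {E : Type*} [Ring E] [Algebra k E]

/-- The mirror image of `sum_map_comm_comul_mul` under the flip of `E ⊗ E`; it serves the other
antipode identity. -/
theorem sum_map_comul_mul_comm (f₁ f₂ f₃ f₄ : C →ₗ[k] E) {c : C} {s : Finset (C × C)}
    (hs : comul (R := k) c = ∑ x ∈ s, x.1 ⊗ₜ[k] x.2) :
    ∑ x ∈ s, TensorProduct.map f₁ f₂ (comul (R := k) x.1) *
        TensorProduct.map f₄ f₃ (TensorProduct.comm k C C (comul (R := k) x.2)) =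
      ∑ x ∈ s, (f₁ x.1 ⊗ₜ 1) * TensorProduct.comm k E E (TensorProduct.map
        (LinearMap.mul' k E ∘ₗ TensorProduct.map f₂ f₃ ∘ₗ comul) f₄ (comul (R := k) x.2)) := by
  have h := congrArg (Algebra.TensorProduct.comm k E E) (sum_map_comm_comul_mul f₁ f₂ f₃ f₄ hs)
  have hc (z : E ⊗[k] E) : Algebra.TensorProduct.comm k E E z = TensorProduct.comm k E E z := rfl
  simp only [map_sum, map_mul, Algebra.TensorProduct.comm_tmul] at h
  simp only [hc] at h
  simpa only [TensorProduct.map_comm, ← TensorProduct.map_comm, TensorProduct.comm_comm] using h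

end Fourfold

section Counit

variable {k : Type*} [Field k] {C : Type*} [AddCommGroup C] [Module k C] [Coalgebra k C]

theorem sum_counit_mul_counit {c : C} {t : Finset (C × C)}
    (ht : comul (R := k) c = ∑ y ∈ t, y.1 ⊗ₜ y.2) :
    ∑ y ∈ t, counit (R := k) y.1 * counit (R := k) y.2 = counit (R := k) c := by
  have h := congrArg (LinearMap.mul' k k ∘ₗ (counit (R := k) (A := C)).lTensor k)
    (rTensor_counit_comul (R := k) c)
  rw [ht] at h
  simpa using h

theorem map_unit_counit_comul_left {E F : Type*} [Ring E] [Algebra k E] [AddCommGroup F]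
    [Module k F] (f : C →ₗ[k] F) (c : C) :
    TensorProduct.map (Algebra.linearMap k E ∘ₗ counit) f (comul (R := k) c) = 1 ⊗ₜ f c := by
  have h := congrArg (TensorProduct.map (Algebra.linearMap k E) f)
    (rTensor_counit_comul (R := k) c)
  rw [LinearMap.rTensor_def, TensorProduct.map_map] at h
  simpa using h

end Counit

/-! ### The antipode induced by a shift of the indices -/

section Antipode

variable {k : Type u} [Field k] {A : Type v} [Ring A] [Algebra k A] {ι : Type}
variable {p : ι → Bool} {r : ι → ι → Prop} {T : Set (A →ₗ[k] k)} {S : Set A}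
variable {B : Type (max u v)} [Ring B] [Bialgebra k B] {β : ι → B →ₗ[k] Module.End k A}

/-- A parity-reversing reindexing is an admissible family on the co-opposite of `B`, so terminality
turns it into an anti-comultiplicative endomorphism. -/
theorem IsUniversalModule.exists_shift (hβ : IsUniversalModule p r T S β)
    (s : ι → ι) (hp : ∀ i, p (s i) = !p i) (hr : ∀ i j, r i j → r (s i) (s j)) :
    ∃ Z : B →ₗ[k] B, (∀ i x, β i (Z x) = β (s i) x) ∧
      (∀ x, counit (R := k) (Z x) = counit (R := k) x) ∧
      ∀ x, comul (R := k) (Z x) =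
        TensorProduct.map Z Z (TensorProduct.comm k B B (comul (R := k) x)) := by
  obtain ⟨f, hf, -⟩ := hβ.universal.2 (CoOp B) _ (hβ.universal.1.coOp s hp hr)
  exact ⟨(f : CoOp B →ₗ[k] B), hf, fun x => CoalgHomClass.counit_comp_apply (A := CoOp B) f x,
    fun x => (CoalgHomClass.map_comp_comul_apply (A := CoOp B) f x).symm⟩

/-- Since `β (s i)` is the convolution inverse of `β i`, the elements `Z(x₁) x₂` and `x₁ Z(x₂)` act
as `ε(x)`. Coinduction upgrades this to equality in `B`, so the shift `Z` is an antipode. -/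
theorem IsUniversalModule.exists_hopfAlgebra (hβ : IsUniversalModule p r T S β)
    (s : ι → ι) (hp : ∀ i, p (s i) = !p i) (hr : ∀ i j, r i j → r (s i) (s j))
    (hs : ∀ i, r i (s i)) :
    ∃ (H : HopfAlgebra k B), H.toBialgebra = ‹Bialgebra k B› ∧
      ∀ i x, β i (H.antipode x) = β (s i) x := by
  obtain ⟨Z, hZ, hε, hΔ⟩ := hβ.exists_shift s hp hr
  have hβ1 := hβ.universal.1
  have hact_alg (i : ι) (a : k) : β i (algebraMap k B a) = algebraMap k _ a := by
    rw [Algebra.algebraMap_eq_smul_one, map_smul, hβ.act_one, Algebra.algebraMap_eq_smul_one]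
  have hcomul_alg (a : k) : comul (R := k) (algebraMap k B a) = algebraMap k B a ⊗ₜ 1 := by
    simp
  have hΔ2 (x : B) : TensorProduct.map Z Z (TensorProduct.comm k B B (comul (R := k) x)) =
    comul (R := k) (Z x) := (hΔ x).symm
  let f : B →ₗ[k] B := LinearMap.mul' k B ∘ₗ TensorProduct.map Z LinearMap.id ∘ₗ comul
  let g : B →ₗ[k] B := LinearMap.mul' k B ∘ₗ TensorProduct.map LinearMap.id Z ∘ₗ comul
  have hf (x : B) (t : Finset (B × B)) (ht : comul (R := k) x = ∑ y ∈ t, y.1 ⊗ₜ y.2) :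
      f x = ∑ y ∈ t, Z y.1 * y.2 := by simp [f, ht]
  have hg (x : B) (t : Finset (B × B)) (ht : comul (R := k) x = ∑ y ∈ t, y.1 ⊗ₜ y.2) :
      g x = ∑ y ∈ t, y.1 * Z y.2 := by simp [g, ht]
  have hf1 (x : B) : f x = algebraMap k B (counit (R := k) x) := by
    refine hβ.universal.coinduction f (fun x => algebraMap k B (counit (R := k) x))
      (fun x => ?_) (fun i x => ?_) (fun X _ _ q hq x => ?_) x
    · obtain ⟨t, ht⟩ := exists_twComul_eq_sum (k := k) false x
      rw [hf x t ht, map_sum]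
      simp [hε, sum_counit_mul_counit ht]
    · obtain ⟨t, ht⟩ := exists_twComul_eq_sum (k := k) false x
      rw [hf x t ht, hact_alg, map_sum]
      have h1 := hβ1.inv_mul _ _ (hs i) x
      have h2 := hβ1.mul_inv _ _ (hs i) x
      simp only [hβ.act_mul, hZ]
      -- Odd actions reverse products, so `Z(x₁) x₂` acts as `β i x₂ * β (s i) x₁`, which is the
      -- other inverse law for the opposite comultiplication.
      cases hi : p i
      · rw [hi, ht] at h1
        simpa using h1
      · rw [hi, twComul_true_apply, ← twComul_false, ht] at h2
        simpa using h2
    · obtain ⟨t, ht⟩ := exists_twComul_eq_sum (k := k) false x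
      -- Here `Δ(Z(x₁) x₂) = Z(x₂) x₃ ⊗ Z(x₁) x₄`. The first leg contains `f`, which `q` cannot tell
      -- from the counit, so the whole collapses to `q 1 ⊗ q (f x)`.
      have h := sum_map_comm_comul_mul Z Z LinearMap.id LinearMap.id ht
      simp only [TensorProduct.map_id, LinearMap.id_apply, hΔ2, ← Bialgebra.comul_mul,
        ← map_sum] at h
      rw [hf x t ht, h, hcomul_alg, map_sum]
      have hq2 (a : B) (z : B ⊗[k] B) : TensorProduct.map q q ((1 ⊗ₜ a) * TensorProduct.map f
          LinearMap.id z) = TensorProduct.map q q ((1 ⊗ₜ a) * TensorProduct.map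
            (Algebra.linearMap k B ∘ₗ counit) LinearMap.id z) := by
        induction z with
        | zero => simp
        | add x y hx hy => simp only [map_add, mul_add, hx, hy]
        | tmul x y => simp [hq]
      have hq3 (y : B) : TensorProduct.map (Algebra.linearMap k B ∘ₗ counit) LinearMap.id
          (comul (R := k) y) = 1 ⊗ₜ y := map_unit_counit_comul_left LinearMap.id y
      calc _ = ∑ y ∈ t, TensorProduct.map q q ((1 ⊗ₜ Z y.1) * (1 ⊗ₜ y.2)) :=
            Finset.sum_congr rfl fun y _ => by rw [← hq3 y.2]; exact hq2 _ _
        _ = q 1 ⊗ₜ q (f x) := by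
            rw [hf x t ht, map_sum, TensorProduct.tmul_sum]
            simp
        _ = _ := by
            rw [hq]
            simp [Algebra.algebraMap_eq_smul_one, TensorProduct.smul_tmul']
  have hg1 (x : B) : g x = algebraMap k B (counit (R := k) x) := by
    refine hβ.universal.coinduction g (fun x => algebraMap k B (counit (R := k) x))
      (fun x => ?_) (fun i x => ?_) (fun X _ _ q hq x => ?_) x
    · obtain ⟨t, ht⟩ := exists_twComul_eq_sum (k := k) false x
      rw [hg x t ht, map_sum]
      simp [hε, sum_counit_mul_counit ht]
    · obtain ⟨t, ht⟩ := exists_twComul_eq_sum (k := k) false x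
      rw [hg x t ht, hact_alg, map_sum]
      have h1 := hβ1.mul_inv _ _ (hs i) x
      have h2 := hβ1.inv_mul _ _ (hs i) x
      simp only [hβ.act_mul, hZ]
      cases hi : p i
      · rw [hi, ht] at h1
        simpa using h1
      · rw [hi, twComul_true_apply, ← twComul_false, ht] at h2
        simpa using h2
    · obtain ⟨t, ht⟩ := exists_twComul_eq_sum (k := k) false x
      -- Here `Δ(x₁ Z(x₂)) = x₁ Z(x₄) ⊗ x₂ Z(x₃)`, and the collapse happens in the second leg.
      have h := sum_map_comul_mul_comm LinearMap.id LinearMap.id Z Z ht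
      simp only [TensorProduct.map_id, LinearMap.id_apply, hΔ2, ← Bialgebra.comul_mul,
        ← map_sum] at h
      rw [hg x t ht, h, hcomul_alg, map_sum]
      have hq2 (a : B) (z : B ⊗[k] B) : TensorProduct.map q q ((a ⊗ₜ 1) * TensorProduct.comm k B B
          (TensorProduct.map g Z z)) = TensorProduct.map q q ((a ⊗ₜ 1) * TensorProduct.comm k B B
            (TensorProduct.map (Algebra.linearMap k B ∘ₗ counit) Z z)) := by
        induction z with
        | zero => simp
        | add x y hx hy => simp only [map_add, mul_add, hx, hy]
        | tmul x y => simp [hq]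
      have hq3 (y : B) : TensorProduct.map (Algebra.linearMap k B ∘ₗ counit) Z (comul (R := k) y) =
          1 ⊗ₜ Z y := map_unit_counit_comul_left Z y
      calc _ = ∑ y ∈ t, TensorProduct.map q q ((y.1 ⊗ₜ 1) *
              TensorProduct.comm k B B (1 ⊗ₜ Z y.2)) :=
            Finset.sum_congr rfl fun y _ => by rw [← hq3 y.2]; exact hq2 _ _
        _ = q (g x) ⊗ₜ q 1 := by
            rw [hg x t ht, map_sum, TensorProduct.sum_tmul]
            simp
        _ = _ := by
            rw [hq]
            simp
  exact ⟨{ antipode := Z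
           mul_antipode_rTensor_comul := LinearMap.ext hf1
           mul_antipode_lTensor_comul := LinearMap.ext hg1 }, rfl, hZ⟩


end Antipode

/-! ### Powers of the antipode as twisted morphisms -/

section HopfAlgebra

variable {k : Type*} [Field k] {D : Type*} [Ring D] [HopfAlgebra k D]

/-- Both sides are convolution inverses of `comul` among linear maps `D → D ⊗ D`. -/
theorem comul_antipode (c : D) : comul (R := k) (HopfAlgebra.antipode k c) =
    TensorProduct.map (HopfAlgebra.antipode k) (HopfAlgebra.antipode k)
      (TensorProduct.comm k D D (comul (R := k) c)) := by
  let G : D →ₗ[k] D ⊗[k] D := TensorProduct.map (HopfAlgebra.antipode k) (HopfAlgebra.antipode k) ∘ₗ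
    (TensorProduct.comm k D D).toLinearMap ∘ₗ comul
  have h : WithConv.toConv G * WithConv.toConv (comul (R := k) (A := D)) = 1 := by
    apply WithConv.ext
    ext c
    obtain ⟨s, hs⟩ := exists_twComul_eq_sum (k := k) false c
    have h1 := sum_map_comm_comul_mul (HopfAlgebra.antipode k) (HopfAlgebra.antipode k)
      LinearMap.id LinearMap.id hs
    have h2 : LinearMap.mul' k D ∘ₗ TensorProduct.map (HopfAlgebra.antipode k) LinearMap.id ∘ₗ
        comul = Algebra.linearMap k D ∘ₗ counit := HopfAlgebra.mul_antipode_rTensor_comul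
    simp only [h2, map_unit_counit_comul_left, TensorProduct.map_id, LinearMap.id_apply,
      Algebra.TensorProduct.tmul_mul_tmul, mul_one, ← TensorProduct.tmul_sum] at h1
    have h3 : ∑ x ∈ s, HopfAlgebra.antipode k x.1 * x.2 = algebraMap k D (counit (R := k) c) := by
      rw [← HopfAlgebra.mul_antipode_rTensor_comul_apply, ← twComul_false, hs]
      simp
    rw [h3] at h1
    rw [LinearMap.convMul_apply, ← twComul_false, hs]
    simp only [map_sum, TensorProduct.map_tmul, LinearMap.mul'_apply]
    refine h1.trans ?_
    simp [LinearMap.convOne_def, Algebra.algebraMap_eq_smul_one, Algebra.TensorProduct.one_def]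
  have := left_inv_eq_right_inv h LinearMap.comul_right_inv
  exact (LinearMap.congr_fun (WithConv.toConv_injective this) c).symm

/-- Both composites are convolution inverses of `g`. -/
theorem antipode_bialgHom {H : Type*} [Ring H] [HopfAlgebra k H] (g : D →ₐc[k] H) (d : D) :
    HopfAlgebra.antipode k (g d) = g (HopfAlgebra.antipode k d) := by
  let gl : D →ₗ[k] H := (g : D →ₗc[k] H)
  have hgl (d : D) : gl d = g d := rfl
  have h1 : WithConv.toConv (HopfAlgebra.antipode k ∘ₗ gl) * WithConv.toConv gl = 1 := by
    apply WithConv.ext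
    ext c
    have h := HopfAlgebra.mul_antipode_rTensor_comul_apply (R := k) (g c)
    rw [← CoalgHomClass.map_comp_comul_apply, ← (ℛ k c).eq] at h
    rw [(ℛ k c).convMul_apply]
    simpa [hgl] using h
  have h2 : WithConv.toConv gl * WithConv.toConv (gl ∘ₗ HopfAlgebra.antipode k) = 1 := by
    apply WithConv.ext
    ext c
    have h := congrArg g (HopfAlgebra.mul_antipode_lTensor_comul_apply (R := k) c)
    rw [← (ℛ k c).eq, AlgHomClass.commutes g] at h
    rw [(ℛ k c).convMul_apply]
    simpa [hgl] using h
  exact LinearMap.congr_fun (WithConv.toConv_injective (left_inv_eq_right_inv h1 h2)) d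

/-- A linear endomorphism of a Hopf algebra that is a morphism (for `false`) or an
anti-morphism (for `true`) of bialgebras. -/
structure IsTwistedHom (b : Bool) (Z : D →ₗ[k] D) : Prop where
  comul_eq : ∀ x, comul (R := k) (Z x) = TensorProduct.map Z Z (twComul k b x)
  counit_eq : ∀ x, counit (R := k) (Z x) = counit (R := k) x
  map_mul : ∀ x y, Z (x * y) = bif b then Z y * Z x else Z x * Z y
  map_one : Z 1 = 1

theorem IsTwistedHom.id : IsTwistedHom false (LinearMap.id : D →ₗ[k] D) :=
  ⟨fun x => by simp, fun _ => rfl, fun _ _ => rfl, rfl⟩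

theorem isTwistedHom_antipode : IsTwistedHom true (HopfAlgebra.antipode k (A := D)) :=
  ⟨comul_antipode, HopfAlgebra.counit_antipode, HopfAlgebra.antipode_mul_antidistrib,
    HopfAlgebra.antipode_one⟩

theorem IsTwistedHom.twComul_eq {b : Bool} {Z : D →ₗ[k] D} (h : IsTwistedHom b Z) (b' : Bool)
    (x : D) : twComul k b' (Z x) = TensorProduct.map Z Z (twComul k (xor b' b) x) := by
  cases b'
  · simpa using h.comul_eq x
  · rw [twComul_true_apply, h.comul_eq, ← TensorProduct.map_comm, comm_twComul]
    simp

theorem IsTwistedHom.comp {b b' : Bool} {Z Z' : D →ₗ[k] D} (h : IsTwistedHom b Z)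
    (h' : IsTwistedHom b' Z') : IsTwistedHom (xor b b') (Z ∘ₗ Z') where
  comul_eq x := by
    rw [LinearMap.comp_apply, h.comul_eq, h'.twComul_eq, TensorProduct.map_map]
  counit_eq x := by rw [LinearMap.comp_apply, h.counit_eq, h'.counit_eq]
  map_mul x y := by
    simp only [LinearMap.comp_apply, h'.map_mul]
    cases b <;> cases b' <;> simp [h.map_mul]
  map_one := by rw [LinearMap.comp_apply, h'.map_one, h.map_one]

theorem IsTwistedHom.inverse {b : Bool} {Z Z' : D →ₗ[k] D} (h : IsTwistedHom b Z)
    (h1 : Z ∘ₗ Z' = LinearMap.id) (h2 : Z' ∘ₗ Z = LinearMap.id) : IsTwistedHom b Z' := by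
  have h1' (x : D) : Z (Z' x) = x := LinearMap.congr_fun h1 x
  have h2' (x : D) : Z' (Z x) = x := LinearMap.congr_fun h2 x
  have hinj : Function.Injective Z := Function.LeftInverse.injective h2'
  refine ⟨fun x => ?_, fun x => ?_, fun x y => hinj ?_, hinj ?_⟩
  · have h3 := h.twComul_eq b (Z' x)
    rw [h1', Bool.xor_self, twComul_false] at h3
    rw [h3, TensorProduct.map_map, h2, TensorProduct.map_id, LinearMap.id_apply]
  · rw [← h.counit_eq, h1']
  · cases b <;> simp [h.map_mul, h1']
  · rw [h1', h.map_one]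

theorem isTwistedHom_antipode_pow (n : ℕ) :
    IsTwistedHom n.bodd (HopfAlgebra.antipode k (A := D) ^ n) := by
  induction n with
  | zero => exact IsTwistedHom.id
  | succ n ih =>
    rw [pow_succ', Nat.bodd_succ, ← Bool.true_xor]
    exact isTwistedHom_antipode.comp ih

variable {A : Type*} [Ring A] [Algebra k A] {ι : Type*}
variable {p : ι → Bool} {r : ι → ι → Prop} {T : Set (A →ₗ[k] k)} {S : Set A}

/-- This turns one Hopf action into the family that a universal object classifies; with `Z i` a
power of the antipode, the inverse laws are the antipode axioms at `Z i c`. -/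
theorem isMultiMeasuring_comp_twisted {Z : ι → D →ₗ[k] D} (hZ : ∀ i, IsTwistedHom (p i) (Z i))
    (hr : ∀ i j, r i j → Z j = HopfAlgebra.antipode k ∘ₗ Z i) {σ : D →ₐ[k] Module.End k A}
    (hσ : IsMultiMeasuring (fun _ : Unit => false) (fun _ _ => False) T S
      (fun _ => σ.toLinearMap)) :
    IsMultiMeasuring p r T S (fun i => σ.toLinearMap ∘ₗ Z i) where
  act_mul i a b c := by
    have h := hσ.act_mul () a b (Z i c)
    rw [twComul_false, (hZ i).comul_eq, TensorProduct.map_map] at h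
    exact h
  act_one i c := by
    rw [← (hZ i).counit_eq]
    exact hσ.act_one () (Z i c)
  functional t ht i a c := by
    rw [← (hZ i).counit_eq]
    exact hσ.functional t ht () a (Z i c)
  fixes a ha i c := by
    rw [← (hZ i).counit_eq]
    exact hσ.fixes a ha () (Z i c)
  mul_inv i j hij c := by
    obtain ⟨s, hs⟩ := exists_twComul_eq_sum (k := k) (p i) c
    have h := congrArg σ (HopfAlgebra.mul_antipode_lTensor_comul_apply (R := k) (Z i c))
    rw [(hZ i).comul_eq, (hZ i).counit_eq, AlgHomClass.commutes] at h
    rw [← h, hs, hr i j hij]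
    simp
  inv_mul i j hij c := by
    obtain ⟨s, hs⟩ := exists_twComul_eq_sum (k := k) (p i) c
    have h := congrArg σ (HopfAlgebra.mul_antipode_rTensor_comul_apply (R := k) (Z i c))
    rw [(hZ i).comul_eq, (hZ i).counit_eq, AlgHomClass.commutes] at h
    rw [← h, hs, hr i j hij]
    simp

end HopfAlgebra

/-! ### Universal objects for algebras -/

section Algebras

/-- The set of functionals given by an optional functional. -/
def optionFunctionals {k A : Type*} [Field k] [Ring A] [Algebra k A] (τ : Option (A →ₗ[k] k)) :
    Set (A →ₗ[k] k) :=
  {t | t ∈ τ}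

/-- The set of elements given by an optional subalgebra. -/
def optionElements {k A : Type*} [Field k] [Ring A] [Algebra k A] (A' : Option (Subalgebra k A)) :
    Set A :=
  {a | ∃ S ∈ A', a ∈ S}

theorem isMeasuring_iff {k : Type*} [Field k] {A : Type*} [Ring A] [Algebra k A]
    {τ : Option (A →ₗ[k] k)} {A' : Option (Subalgebra k A)}
    {C : Type*} [AddCommGroup C] [Module k C] [Coalgebra k C] {act : C →ₗ[k] Module.End k A} :
    IsMeasuring τ A' act ↔ IsMultiMeasuring (fun _ : Unit => false) (fun _ _ => False)
      (optionFunctionals τ) (optionElements A') (fun _ => act) :=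
  ⟨fun h => ⟨fun _ a b c => h.act_mul c a b, fun _ => h.act_one,
    fun t ht _ a c => h.functional t ht c a, fun a ⟨S, hS, ha⟩ _ c => h.fixes S hS c a ha,
    fun _ _ h => h.elim, fun _ _ h => h.elim⟩,
  fun h => ⟨fun c a b => h.act_mul () a b c, h.act_one (), fun t ht c a => h.functional t ht () a c,
    fun S hS c a ha => h.fixes a ⟨S, hS, ha⟩ () c⟩⟩

variable {k : Type u} [Field k] {A : Type v} [Ring A] [Algebra k A]
  {τ : Option (A →ₗ[k] k)} {A' : Option (Subalgebra k A)}

theorem isUniversalCoalgebra_iff {M : Type (max u v)} [AddCommGroup M] [Module k M] [Coalgebra k M]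
    {act : M →ₗ[k] Module.End k A} :
    IsUniversalCoalgebra τ A' act ↔ IsUniversalFamily (fun _ : Unit => false) (fun _ _ => False)
      (optionFunctionals τ) (optionElements A') (fun _ => act) := by
  refine and_congr isMeasuring_iff ⟨fun h C _ _ _ γ hγ => ?_, fun h C _ _ _ γ hγ => ?_⟩
  · obtain ⟨f, hf, hf'⟩ := h C (γ ()) (isMeasuring_iff.2 hγ)
    exact ⟨f, fun _ c => LinearMap.ext (hf c),
      fun g hg => hf' g fun c a => LinearMap.congr_fun (hg () c) a⟩
  · obtain ⟨f, hf, hf'⟩ := h C (fun _ => γ) (isMeasuring_iff.1 hγ)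
    exact ⟨f, fun c a => LinearMap.congr_fun (hf () c) a,
      fun g hg => hf' g fun _ c => LinearMap.ext (hg c)⟩

theorem exists_isUniversalCoalgebra (τ : Option (A →ₗ[k] k)) (A' : Option (Subalgebra k A)) :
    ∃ (M : Type (max u v)) (_ : AddCommGroup M) (_ : Module k M) (_ : Coalgebra k M)
      (act : M →ₗ[k] Module.End k A), IsUniversalCoalgebra τ A' act := by
  obtain ⟨M, _, _, _, β, hβ⟩ := exists_isUniversalFamily (fun _ : Unit => false)
    (fun _ _ => False) (optionFunctionals τ) (optionElements A')
  exact ⟨M, _, _, _, β (), isUniversalCoalgebra_iff.2 hβ⟩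

/-- The algebra homomorphism underlying an even action of a universal bialgebra. -/
def IsUniversalModule.toAlgHom {ι : Type} {p : ι → Bool} {r : ι → ι → Prop}
    {T : Set (A →ₗ[k] k)} {S : Set A} {B : Type (max u v)} [Ring B] [Bialgebra k B]
    {β : ι → B →ₗ[k] Module.End k A} (hβ : IsUniversalModule p r T S β) (i : ι)
    (hi : p i = false) : B →ₐ[k] Module.End k A :=
  AlgHom.ofLinearMap (β i) (hβ.act_one i) fun x y => by simp [hβ.act_mul, hi]

theorem IsUniversalModule.isUniversalBialgebra {B : Type (max u v)} [Ring B] [Bialgebra k B]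
    {ρ : B →ₐ[k] Module.End k A}
    (hβ : IsUniversalModule (fun _ : Unit => false) (fun _ _ => False)
      (optionFunctionals τ) (optionElements A') (fun _ => ρ.toLinearMap)) :
    IsUniversalBialgebra τ A' ρ := by
  refine ⟨isMeasuring_iff.2 hβ.universal.1, fun D _ _ σ hσ => ?_⟩
  obtain ⟨f, hf⟩ := hβ.exists_bialgHom (isMeasuring_iff.1 hσ) (by simp) (by simp)
  refine ⟨f, fun d a => LinearMap.congr_fun (hf () d) a,
    fun g hg => hβ.bialgHom_ext fun i d => ?_⟩
  rw [hf i]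
  exact LinearMap.ext (hg d)

theorem IsUniversalCoalgebra.exists_isUniversalBialgebra {M : Type (max u v)} [AddCommGroup M]
    [Module k M] [Coalgebra k M] {act : M →ₗ[k] Module.End k A}
    (h : IsUniversalCoalgebra τ A' act) :
    ∃ (B : Type (max u v)) (_ : Ring B) (_ : Bialgebra k B) (e : B ≃ₗc[k] M)
      (ρ : B →ₐ[k] Module.End k A),
      (∀ (b : B) (a : A), ρ b a = act (e b) a) ∧ IsUniversalBialgebra τ A' ρ := by
  have hM := isUniversalCoalgebra_iff.1 h
  obtain ⟨B, _, _, e, hmul, hone⟩ := hM.exists_bialgebra (by simp)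
  have hB : IsUniversalModule _ _ _ _ _ := ⟨hM.of_equiv e, hmul, hone⟩
  exact ⟨B, _, _, e, hB.toAlgHom () rfl, fun _ _ => rfl, IsUniversalModule.isUniversalBialgebra hB⟩

/-- Indexing by `ℕ` suffices, as an antipode need not be invertible; a Hopf action `σ` corresponds
to the sequence `σ ∘ Sⁿ`. -/
theorem exists_isUniversalHopf (τ : Option (A →ₗ[k] k)) (A' : Option (Subalgebra k A)) :
    ∃ (H : Type (max u v)) (_ : Ring H) (_ : HopfAlgebra k H) (ρ : H →ₐ[k] Module.End k A),
      IsUniversalHopf τ A' ρ := by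
  obtain ⟨H, _, _, β, hβ⟩ := exists_isUniversalModule Nat.bodd (fun i j => j = i + 1)
    (optionFunctionals τ) (optionElements A') (by rintro i _ rfl; simp)
  obtain ⟨hH, rfl, hS⟩ := hβ.exists_hopfAlgebra (fun i => i + 1) (by simp) (by simp) (by simp)
  have hm := hβ.universal.1
  refine ⟨H, _, hH, hβ.toAlgHom 0 rfl, isMeasuring_iff.2
    ⟨fun _ => hm.act_mul 0, fun _ => hm.act_one 0, fun t ht _ => hm.functional t ht 0,
      fun a ha _ => hm.fixes a ha 0, fun _ _ h => h.elim, fun _ _ h => h.elim⟩,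
    fun D _ _ σ hσ => ?_⟩
  have hZ := isTwistedHom_antipode_pow (k := k) (D := D)
  obtain ⟨f, hf⟩ := hβ.exists_bialgHom (isMultiMeasuring_comp_twisted hZ
    (by rintro i _ rfl; rw [pow_succ']; rfl) (isMeasuring_iff.1 hσ))
    (fun i x y => by
      rw [LinearMap.comp_apply, (hZ i).map_mul]
      cases i.bodd <;> simp)
    (fun i => by simp [(hZ i).map_one])
  refine ⟨f, fun d a => LinearMap.congr_fun (hf 0 d) a, fun g hg => hβ.bialgHom_ext fun n d => ?_⟩
  rw [hf]
  -- Uniqueness is given only for the action of index zero. Since `g` commutes with antipodes, which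
  -- raise the index by one, it determines all the others.
  induction n generalizing d with
  | zero => exact LinearMap.ext (hg d)
  | succ n ih =>
    rw [← hS]
    exact (congrArg (β n) (antipode_bialgHom g d)).trans (ih _)

end Algebras

/-! ### Conjugate coalgebras and conjugate actions -/

section Conj

variable {C : Type*} [AddCommGroup C] [Module ℂ C]

/-- The complex conjugate of a complex vector space. -/
def Conj (C : Type*) : Type _ := C

instance : AddCommGroup (Conj C) := inferInstanceAs (AddCommGroup C)

noncomputable instance : Module ℂ (Conj C) := Module.compHom C (starRingEnd ℂ)

/-- The conjugate-linear identity map. -/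
noncomputable def toConj : C →ₗ⋆[ℂ] Conj C where
  toFun x := x
  map_add' _ _ := rfl
  map_smul' c x := by
    change c • x = starRingEnd ℂ (starRingEnd ℂ c) • x
    rw [Complex.conj_conj]

/-- The inverse of `toConj`. -/
noncomputable def ofConj : Conj C →ₗ⋆[ℂ] C where
  toFun x := x
  map_add' _ _ := rfl
  map_smul' _ _ := rfl

@[simp] theorem ofConj_toConj (x : C) : ofConj (toConj x) = x := rfl

variable [Coalgebra ℂ C]

noncomputable instance : CoalgebraStruct ℂ (Conj C) where
  comul := TensorProduct.map toConj toConj ∘ₛₗ (comul (R := ℂ) (A := C)) ∘ₛₗ ofConj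
  counit := (starLinearEquiv ℂ (A := ℂ)).toLinearMap ∘ₛₗ (counit (R := ℂ) (A := C)) ∘ₛₗ ofConj

theorem comul_toConj (x : C) :
    comul (R := ℂ) (toConj x) = TensorProduct.map toConj toConj (comul (R := ℂ) x) := rfl

theorem counit_toConj (x : C) :
    counit (R := ℂ) (toConj x) = starRingEnd ℂ (counit (R := ℂ) x) := rfl

noncomputable instance : Coalgebra ℂ (Conj C) where
  coassoc := by
    have h1 (t : C ⊗[ℂ] C) : comul.rTensor (Conj C) (TensorProduct.map toConj toConj t) =
        TensorProduct.map (TensorProduct.map toConj toConj) toConj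
          (comul.rTensor C t) := by
      induction t with
      | zero => simp
      | add x y hx hy => simp only [map_add, hx, hy]
      | tmul x y => rfl
    have h2 (t : C ⊗[ℂ] C) : comul.lTensor (Conj C) (TensorProduct.map toConj toConj t) =
        TensorProduct.map toConj (TensorProduct.map toConj toConj)
          (comul.lTensor C t) := by
      induction t with
      | zero => simp
      | add x y hx hy => simp only [map_add, hx, hy]
      | tmul x y => rfl
    have h3 (t : (C ⊗[ℂ] C) ⊗[ℂ] C) : TensorProduct.assoc ℂ (Conj C) (Conj C) (Conj C)
        (TensorProduct.map (TensorProduct.map toConj toConj) toConj t) =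
        TensorProduct.map toConj (TensorProduct.map toConj toConj)
          (TensorProduct.assoc ℂ C C C t) := by
      induction t with
      | zero => simp
      | add x y hx hy => simp only [map_add, hx, hy]
      | tmul t z =>
        induction t with
        | zero => simp
        | add x y hx hy => simp only [TensorProduct.add_tmul, map_add, hx, hy]
        | tmul x y => rfl
    ext x
    obtain ⟨x, rfl⟩ : ∃ y : C, toConj y = x := ⟨ofConj x, rfl⟩
    simp only [LinearMap.comp_apply, LinearEquiv.coe_coe]
    rw [comul_toConj, h1, h2, h3, coassoc_apply]
  rTensor_counit_comp_comul := by
    have h1 (t : C ⊗[ℂ] C) : counit.rTensor (Conj C) (TensorProduct.map toConj toConj t) =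
        TensorProduct.map (starLinearEquiv ℂ (A := ℂ)).toLinearMap toConj
          (counit.rTensor C t) := by
      induction t with
      | zero => simp
      | add x y hx hy => simp only [map_add, hx, hy]
      | tmul x y => rfl
    ext x
    obtain ⟨x, rfl⟩ : ∃ y : C, toConj y = x := ⟨ofConj x, rfl⟩
    rw [LinearMap.comp_apply, comul_toConj, h1, rTensor_counit_comul]
    simp
  lTensor_counit_comp_comul := by
    have h1 (t : C ⊗[ℂ] C) : counit.lTensor (Conj C) (TensorProduct.map toConj toConj t) =
        TensorProduct.map toConj (starLinearEquiv ℂ (A := ℂ)).toLinearMap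
          (counit.lTensor C t) := by
      induction t with
      | zero => simp
      | add x y hx hy => simp only [map_add, hx, hy]
      | tmul x y => rfl
    ext x
    obtain ⟨x, rfl⟩ : ∃ y : C, toConj y = x := ⟨ofConj x, rfl⟩
    rw [LinearMap.comp_apply, comul_toConj, h1, lTensor_counit_comul]
    simp

theorem twComul_toConj (b : Bool) (x : C) :
    twComul ℂ b (toConj x) = TensorProduct.map toConj toConj (twComul ℂ b x) := by
  cases b
  · rfl
  · rw [twComul_true_apply, comul_toConj, twComul_true_apply, TensorProduct.map_comm]

end Conj

section ConjEnd

variable {A : Type*} [AddCommGroup A] [StarAddMonoid A] [Module ℂ A] [StarModule ℂ A]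

/-- The conjugate `a ↦ (T a^*)^*` of an endomorphism `T`. -/
noncomputable def conjEnd : Module.End ℂ A →ₗ⋆[ℂ] Module.End ℂ A where
  toFun Φ := (starLinearEquiv ℂ (A := A)).toLinearMap ∘ₛₗ Φ ∘ₛₗ
    (starLinearEquiv ℂ (A := A)).toLinearMap
  map_add' Φ Ψ := by ext; simp
  map_smul' c Φ := by ext; simp

@[simp] theorem conjEnd_apply (Φ : Module.End ℂ A) (a : A) :
    conjEnd Φ a = star (Φ (star a)) := rfl

@[simp] theorem conjEnd_conjEnd (Φ : Module.End ℂ A) : conjEnd (conjEnd Φ) = Φ := by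
  ext; simp

@[simp] theorem conjEnd_mul (Φ Ψ : Module.End ℂ A) : conjEnd (Φ * Ψ) = conjEnd Φ * conjEnd Ψ := by
  ext; simp

@[simp] theorem conjEnd_one : conjEnd (1 : Module.End ℂ A) = 1 := by
  ext; simp

/-- The conjugate `a ↦ conj (t a^*)` of a functional `t`. -/
noncomputable def conjFunctional (t : A →ₗ[ℂ] ℂ) : A →ₗ[ℂ] ℂ :=
  (starLinearEquiv ℂ (A := ℂ)).toLinearMap ∘ₛₗ t ∘ₛₗ (starLinearEquiv ℂ (A := A)).toLinearMap

@[simp] theorem conjFunctional_apply (t : A →ₗ[ℂ] ℂ) (a : A) :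
    conjFunctional t a = starRingEnd ℂ (t (star a)) := rfl

@[simp] theorem conjFunctional_conjFunctional (t : A →ₗ[ℂ] ℂ) :
    conjFunctional (conjFunctional t) = t := by
  ext; simp

end ConjEnd

section ConjMeasuring

variable {A : Type*} [Ring A] [StarRing A] [Algebra ℂ A] [StarModule ℂ A] {ι : Type*}
variable {p : ι → Bool} {r : ι → ι → Prop} {T : Set (A →ₗ[ℂ] ℂ)} {S : Set A}
variable {C : Type*} [AddCommGroup C] [Module ℂ C] [Coalgebra ℂ C]

/-- The conjugate of an action of `C`, as an action of the conjugate of `C`. -/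
noncomputable def conjAct (γ : C →ₗ[ℂ] Module.End ℂ A) : Conj C →ₗ[ℂ] Module.End ℂ A :=
  conjEnd ∘ₛₗ γ ∘ₛₗ ofConj

omit [Coalgebra ℂ C] in
@[simp] theorem conjAct_toConj (γ : C →ₗ[ℂ] Module.End ℂ A) (c : C) :
    conjAct γ (toConj c) = conjEnd (γ c) := rfl

/-- The star of `A` reverses products, so conjugation flips parity. Conjugation on `Module.End ℂ A`
preserves products, so after the flip the two inverse laws trade places; hence the reindexing
reverses the relation. -/
theorem IsMultiMeasuring.conj {β : ι → C →ₗ[ℂ] Module.End ℂ A} (h : IsMultiMeasuring p r T S β)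
    (hT : ∀ t ∈ T, conjFunctional t ∈ T) (hS : ∀ a ∈ S, star a ∈ S)
    (hpr : ∀ i j, r i j → p j = !p i)
    {ι' : Type*} {p' : ι' → Bool} {r' : ι' → ι' → Prop} (s : ι' → ι) (hp : ∀ i, p (s i) = !p' i)
    (hr : ∀ i j, r' i j → r (s j) (s i)) :
    IsMultiMeasuring (C := Conj C) p' r' T S (fun i => conjAct (β (s i))) := by
  have hsum (b : Bool) (c : C) : ∃ s : Finset (C × C), twComul ℂ b c = ∑ x ∈ s, x.1 ⊗ₜ[ℂ] x.2 ∧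
      twComul ℂ b (toConj c) = ∑ x ∈ s, toConj x.1 ⊗ₜ[ℂ] toConj x.2 := by
    obtain ⟨s, hs⟩ := exists_twComul_eq_sum (k := ℂ) b c
    exact ⟨s, hs, by rw [twComul_toConj, hs]; simp⟩
  refine ⟨fun i a b c => ?_, fun i c => ?_, fun t ht i a c => ?_, fun a ha i c => ?_,
    fun i j hij c => ?_, fun i j hij c => ?_⟩ <;>
  obtain ⟨c, rfl⟩ : ∃ y : C, toConj y = c := ⟨ofConj c, rfl⟩
  · obtain ⟨t, ht, ht'⟩ := hsum (p' i) c
    have h1 := h.act_mul (s i) (star b) (star a) c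
    rw [hp, ← comm_twComul, ht] at h1
    rw [ht', conjAct_toConj, conjEnd_apply, star_mul, h1]
    simp
  · simp [h.act_one, counit_toConj, Algebra.algebraMap_eq_smul_one]
  · have h1 := h.functional _ (hT t ht) (s i) (star a) c
    simp only [conjFunctional_apply, star_star] at h1
    rw [conjAct_toConj, conjEnd_apply, counit_toConj, ← Complex.conj_conj (t _), h1]
    simp
  · rw [conjAct_toConj, conjEnd_apply, h.fixes _ (hS a ha), counit_toConj]
    simp
  · obtain ⟨t, ht, ht'⟩ := hsum (p' i) c
    have h1 := h.inv_mul _ _ (hr i j hij) c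
    have h2 := hpr _ _ (hr i j hij)
    rw [hp] at h2
    rw [← Bool.not_inj h2, ht] at h1
    have h3 := congrArg conjEnd h1
    rw [ht', counit_toConj]
    simpa [Algebra.algebraMap_eq_smul_one] using h3
  · obtain ⟨t, ht, ht'⟩ := hsum (p' i) c
    have h1 := h.mul_inv _ _ (hr i j hij) c
    have h2 := hpr _ _ (hr i j hij)
    rw [hp] at h2
    rw [← Bool.not_inj h2, ht] at h1
    have h3 := congrArg conjEnd h1
    rw [ht', counit_toConj]
    simpa [Algebra.algebraMap_eq_smul_one] using h3

end ConjMeasuring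

/-! ### Conjugations of universal families -/

section SemilinearStar

variable {A : Type v} [Ring A] [StarRing A] [Algebra ℂ A] [StarModule ℂ A] {ι : Type}
variable {p : ι → Bool} {r : ι → ι → Prop} {T : Set (A →ₗ[ℂ] ℂ)} {S : Set A}
variable {M : Type v} [AddCommGroup M] [Module ℂ M] [Coalgebra ℂ M]
  {β : ι → M →ₗ[ℂ] Module.End ℂ A}

/-- A conjugate-linear morphism (for `false`) or anti-morphism (for `true`) of coalgebras that
intertwines the action `β i` with the conjugate of the action `β (s i)`. -/
structure IsConjugation (b : Bool) (β : ι → M →ₗ[ℂ] Module.End ℂ A) (s : ι → ι)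
    (Z : M →ₗ⋆[ℂ] M) : Prop where
  act : ∀ i x, β i (Z x) = conjEnd (β (s i) x)
  counit_eq : ∀ x, counit (R := ℂ) (Z x) = starRingEnd ℂ (counit (R := ℂ) x)
  comul_eq : ∀ x, comul (R := ℂ) (Z x) = TensorProduct.map Z Z (twComul ℂ b x)

/-- Terminality is applied to the conjugate coalgebra of `M`; the parity flip is absorbed by the
reindexing `s`. -/
theorem IsUniversalFamily.exists_isConjugation_false (hβ : IsUniversalFamily.{0, v} p r T S β)
    (hT : ∀ t ∈ T, conjFunctional t ∈ T) (hS : ∀ a ∈ S, star a ∈ S)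
    (hpr : ∀ i j, r i j → p j = !p i) (s : ι → ι) (hp : ∀ i, p (s i) = !p i)
    (hr : ∀ i j, r i j → r (s j) (s i)) :
    ∃ Z : M →ₗ⋆[ℂ] M, IsConjugation false β s Z := by
  obtain ⟨f, hf, -⟩ := hβ.2 (Conj M) _ (hβ.1.conj hT hS hpr s hp hr)
  refine ⟨(f : Conj M →ₗ[ℂ] M) ∘ₛₗ toConj, fun i x => hf i (toConj x),
    fun x => CoalgHomClass.counit_comp_apply f (toConj x), fun x => ?_⟩
  refine (CoalgHomClass.map_comp_comul_apply f (toConj x)).symm.trans ?_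
  rw [comul_toConj, TensorProduct.map_map]
  rfl

/-- Without a reindexing, the parity flip caused by conjugation is undone by the co-opposite, so the
conjugation reverses the comultiplication. -/
theorem IsUniversalFamily.exists_isConjugation_true
    (hβ : IsUniversalFamily.{0, v} p (fun _ _ => False) T S β)
    (hT : ∀ t ∈ T, conjFunctional t ∈ T) (hS : ∀ a ∈ S, star a ∈ S) :
    ∃ Z : M →ₗ⋆[ℂ] M, IsConjugation true β id Z := by
  have h1 : IsMultiMeasuring (C := Conj M) (fun i => !p i) (fun _ _ => False) T S
    (fun i => conjAct (β i)) := hβ.1.conj hT hS (by simp) id (by simp) (by simp)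
  obtain ⟨f, hf, -⟩ := hβ.2 (CoOp (Conj M)) _
    (h1.coOp (p' := p) (r' := fun _ _ => False) id (by simp) (by simp))
  let g : Conj M →ₗ[ℂ] M := (f : CoOp (Conj M) →ₗ[ℂ] M)
  refine ⟨g ∘ₛₗ toConj, fun i x => hf i (toConj x),
    fun x => CoalgHomClass.counit_comp_apply (A := CoOp (Conj M)) f (toConj x), fun x => ?_⟩
  refine (CoalgHomClass.map_comp_comul_apply (A := CoOp (Conj M)) f (toConj x)).symm.trans ?_
  change TensorProduct.map g g (twComul ℂ true (toConj x)) = _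
  rw [twComul_toConj, TensorProduct.map_map]

theorem twComul_of_comul_eq {C D : Type*} [AddCommGroup C] [Module ℂ C] [Coalgebra ℂ C]
    [AddCommGroup D] [Module ℂ D] [Coalgebra ℂ D] {b : Bool} {Z : C →ₗ⋆[ℂ] D}
    (h : ∀ x, comul (R := ℂ) (Z x) = TensorProduct.map Z Z (twComul ℂ b x)) (b' : Bool) (x : C) :
    twComul ℂ b' (Z x) = TensorProduct.map Z Z (twComul ℂ (xor b' b) x) := by
  cases b'
  · simpa using h x
  · rw [twComul_true_apply, h, ← TensorProduct.map_comm, comm_twComul]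
    simp

/-- A conjugation for an involutive reindexing is an involution. -/
theorem IsConjugation.involutive {b : Bool} {s : ι → ι} {Z : M →ₗ⋆[ℂ] M}
    (hZ : IsConjugation b β s Z) (hβ : IsUniversalFamily.{0, v} p r T S β)
    (hs : ∀ i, s (s i) = i) (x : M) : Z (Z x) = x := by
  refine hβ.coinduction (fun x => Z (Z x)) id (fun x => by simp [hZ.counit_eq])
    (fun i x => by simp [hZ.act, hs]) (fun X _ _ q hq x => ?_) x
  rw [hZ.comul_eq, twComul_of_comul_eq hZ.comul_eq, Bool.xor_self, twComul_false,
    TensorProduct.map_map, TensorProduct.map_map]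
  congr 2 <;> exact LinearMap.ext hq

end SemilinearStar

/-! ### Involutions on coalgebras -/

section StarCoalgebra

theorem counit_right_twComul {C : Type*} [AddCommGroup C] [Module ℂ C] [Coalgebra ℂ C] (b : Bool) {c : C} {s : Finset (C × C)}
    (hs : twComul ℂ b c = ∑ x ∈ s, x.1 ⊗ₜ[ℂ] x.2) : ∑ x ∈ s, counit (R := ℂ) x.2 • x.1 = c := by
  cases b
  · have h := congrArg (TensorProduct.rid ℂ C) (lTensor_counit_comul (R := ℂ) c)
    rw [← twComul_false, hs] at h
    simpa using h
  · have h := congrArg (TensorProduct.lid ℂ C) (rTensor_counit_comul (R := ℂ) c)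
    have h1 := congrArg (TensorProduct.comm ℂ C C) hs
    rw [comm_twComul, Bool.not_true, twComul_false] at h1
    rw [h1] at h
    simpa using h

/-- The involution as a conjugate-linear map. -/
noncomputable def starMap (C : Type*) [AddCommGroup C] [Module ℂ C] [StarAddMonoid C]
    [StarModule ℂ C] : C →ₗ⋆[ℂ] C :=
  (starLinearEquiv ℂ (A := C)).toLinearMap

variable {C : Type*} [AddCommGroup C] [Module ℂ C] [StarAddMonoid C] [StarModule ℂ C]

@[simp] theorem starMap_apply (c : C) : starMap C c = star c := rfl

theorem star_tensor_eq (t : C ⊗[ℂ] C) :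
    star t = TensorProduct.map (starMap C) (starMap C) t := rfl

variable [Coalgebra ℂ C]

theorem isStarCoalgebra_iff : IsStarCoalgebra C ↔ ∀ c : C,
    comul (R := ℂ) (starMap C c) =
      TensorProduct.map (starMap C) (starMap C) (twComul ℂ true c) := by
  refine ⟨fun h c => ?_, fun h => ⟨fun c => ?_⟩⟩
  · rw [starMap_apply, h.comul_star, star_tensor_eq, twComul_true_apply, TensorProduct.map_comm]
  · rw [star_tensor_eq, ← TensorProduct.map_comm, ← twComul_true_apply]
    exact h c

/-- An involution that preserves or reverses the comultiplication is compatible with the counit. -/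
theorem counit_star_of_comul_eq {b : Bool} (h : ∀ c : C, comul (R := ℂ) (starMap C c) =
    TensorProduct.map (starMap C) (starMap C) (twComul ℂ b c)) (c : C) :
    counit (R := ℂ) (star c) = starRingEnd ℂ (counit (R := ℂ) c) := by
  classical
  obtain ⟨s, hs⟩ := exists_twComul_eq_sum (k := ℂ) b c
  have h1 := rTensor_counit_comul (R := ℂ) (starMap C c)
  rw [h, hs] at h1
  -- Applying `ε ∘ star` to the counit laws of `c^*` and of `c` expresses `ε(c)` and `ε(c^*)` as
  -- sums that are termwise conjugate.
  have h2 := congrArg (fun x => counit (R := ℂ) (star x)) (congrArg (TensorProduct.lid ℂ C) h1)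
  have h3 := congrArg (fun x => counit (R := ℂ) (star x)) (counit_right_twComul b hs)
  simp only [map_sum, TensorProduct.map_tmul, LinearMap.rTensor_tmul, TensorProduct.lid_tmul,
    starMap_apply, star_sum, star_smul, star_star, one_smul, map_smul, smul_eq_mul] at h2 h3
  rw [← h2, ← h3, map_sum]
  refine Finset.sum_congr rfl fun x _ => ?_
  simp [mul_comm]

theorem counit_star [IsStarCoalgebra C] (c : C) :
    counit (R := ℂ) (star c) = starRingEnd ℂ (counit (R := ℂ) c) :=
  counit_star_of_comul_eq (isStarCoalgebra_iff.1 ‹_›) c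

end StarCoalgebra

/-! ### Making the functional and the subalgebra self-adjoint -/

section Symmetrized

variable {A : Type*} [Ring A] [StarRing A] [Algebra ℂ A] [StarModule ℂ A]

/-- The given functional and its conjugate. -/
def symFunctionals (τ : Option (A →ₗ[ℂ] ℂ)) : Set (A →ₗ[ℂ] ℂ) :=
  {t | t ∈ τ ∨ conjFunctional t ∈ τ}

/-- The elements of the given subalgebra and their adjoints. -/
def symElements (A' : Option (Subalgebra ℂ A)) : Set A :=
  {a | ∃ S ∈ A', a ∈ S ∨ star a ∈ S}

variable {τ : Option (A →ₗ[ℂ] ℂ)} {A' : Option (Subalgebra ℂ A)}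

theorem conjFunctional_mem_symFunctionals :
    ∀ t ∈ symFunctionals τ, conjFunctional t ∈ symFunctionals τ := by
  rintro t (h | h)
  · exact Or.inr (by rwa [conjFunctional_conjFunctional])
  · exact Or.inl h

omit [StarModule ℂ A] in
theorem star_mem_symElements : ∀ a ∈ symElements A', star a ∈ symElements A' := by
  rintro a ⟨S, hS, h | h⟩
  · exact ⟨S, hS, Or.inr (by rwa [star_star])⟩
  · exact ⟨S, hS, Or.inl h⟩

variable {C : Type*} [AddCommGroup C] [Module ℂ C] [Coalgebra ℂ C] {act : C →ₗ[ℂ] Module.End ℂ A}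

/-- Invariance under `θ c`, once conjugated, is invariance of the conjugate data under `c`. The map
`θ` is the star for `∗`-coalgebras and `h ↦ S(h)^*` for Hopf `∗`-algebras. -/
theorem IsMeasuring.isMultiMeasuring_sym (h : IsMeasuring τ A' act) (θ : C → C)
    (hθ : ∀ c, act (θ c) = conjEnd (act c))
    (hε : ∀ c, counit (R := ℂ) (θ c) = starRingEnd ℂ (counit (R := ℂ) c)) :
    IsMultiMeasuring (fun _ : Unit => false) (fun _ _ => False) (symFunctionals τ)
      (symElements A') (fun _ => act) where
  act_mul _ a b c := h.act_mul c a b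
  act_one _ := h.act_one
  functional t ht _ a c := by
    rcases ht with ht | ht
    · exact h.functional t ht c a
    · have h1 := h.functional _ ht (θ c) (star a)
      rw [hθ, hε] at h1
      simp only [conjFunctional_apply, conjEnd_apply, star_star, ← map_mul] at h1
      exact (starRingEnd ℂ).injective h1
  fixes a ha _ c := by
    obtain ⟨S, hS, ha | ha⟩ := ha
    · exact h.fixes S hS c a ha
    · have h1 := h.fixes S hS (θ c) _ ha
      rw [hθ, hε] at h1
      simp only [conjEnd_apply, star_star] at h1
      apply star_injective
      rw [h1]
      simp
  mul_inv _ _ h := h.elim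
  inv_mul _ _ h := h.elim

theorem IsMultiMeasuring.isMeasuring_of_sym {ι : Type*} {p : ι → Bool} {r : ι → ι → Prop}
    {β : ι → C →ₗ[ℂ] Module.End ℂ A}
    (h : IsMultiMeasuring p r (symFunctionals τ) (symElements A') β) (i : ι) (hi : p i = false) :
    IsMeasuring τ A' (β i) where
  act_mul c a b := by
    have := h.act_mul i a b c
    rwa [hi] at this
  act_one := h.act_one i
  functional t ht c a := h.functional t (Or.inl ht) i a c
  fixes S hS c a ha := h.fixes a ⟨S, hS, Or.inl ha⟩ i c

theorem IsStarMeasuring.act_star [StarAddMonoid C] (h : IsStarMeasuring τ A' act) (c : C) :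
    act (star c) = conjEnd (act c) := by
  ext a
  rw [conjEnd_apply, h.star_act, star_star]

theorem IsStarMeasuring.isMultiMeasuring [StarAddMonoid C] [StarModule ℂ C] [IsStarCoalgebra C]
    (h : IsStarMeasuring τ A' act) :
    IsMultiMeasuring (fun _ : Unit => false) (fun _ _ => False) (symFunctionals τ)
      (symElements A') (fun _ => act) :=
  h.toIsMeasuring.isMultiMeasuring_sym star h.act_star counit_star

end Symmetrized

/-! ### Universal star coalgebras and star bialgebras -/

section UniversalStar

variable {A : Type v} [Ring A] [StarRing A] [Algebra ℂ A] [StarModule ℂ A]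

/-- Coalgebra maps into a universal family commute with the conjugations. -/
theorem IsConjugation.map_star {ι : Type} {p : ι → Bool} {r : ι → ι → Prop}
    {T : Set (A →ₗ[ℂ] ℂ)} {S : Set A} {M : Type v} [AddCommGroup M] [Module ℂ M] [Coalgebra ℂ M]
    {β : ι → M →ₗ[ℂ] Module.End ℂ A} {b : Bool} {s : ι → ι} {Z : M →ₗ⋆[ℂ] M}
    (hZ : IsConjugation b β s Z) (hβ : IsUniversalFamily.{0, v} p r T S β)
    {C : Type*} [AddCommGroup C] [Module ℂ C] [Coalgebra ℂ C] [StarAddMonoid C] [StarModule ℂ C]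
    (hC : ∀ c : C, comul (R := ℂ) (starMap C c) =
      TensorProduct.map (starMap C) (starMap C) (twComul ℂ b c)) (f : C →ₗc[ℂ] M)
    (hf : ∀ i c, β i (f (star c)) = conjEnd (β (s i) (f c))) (c : C) : f (star c) = Z (f c) := by
  refine hβ.coinduction (fun c => f (star c)) (fun c => Z (f c))
    (fun c => by simp [hZ.counit_eq, counit_star_of_comul_eq hC])
    (fun i c => by rw [hf, hZ.act]) (fun X _ _ q hq c => ?_) c
  obtain ⟨t, ht⟩ := exists_twComul_eq_sum (k := ℂ) b c
  have h1 := hC c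
  rw [starMap_apply] at h1
  rw [← CoalgHomClass.map_comp_comul_apply, h1, hZ.comul_eq, twComul_map, ht]
  simp [hq]

/-- The universal plain coalgebra for the symmetrized data carries the involution. Recording both
universal properties allows the plain one to be transferred to any universal `∗`-coalgebra. -/
theorem exists_isUniversalStarCoalgebra_and (τ : Option (A →ₗ[ℂ] ℂ))
    (A' : Option (Subalgebra ℂ A)) :
    ∃ (M : Type v) (_ : AddCommGroup M) (_ : Module ℂ M) (_ : Coalgebra ℂ M)
      (_ : StarAddMonoid M) (_ : StarModule ℂ M) (_ : IsStarCoalgebra M)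
      (act : M →ₗ[ℂ] Module.End ℂ A), IsUniversalStarCoalgebra τ A' act ∧
        IsUniversalFamily.{0, v} (fun _ : Unit => false) (fun _ _ => False) (symFunctionals τ)
          (symElements A') (fun _ => act) := by
  obtain ⟨M, _, _, _, β, hβ⟩ := exists_isUniversalFamily.{0, v} (fun _ : Unit => false)
    (fun _ _ => False) (symFunctionals τ) (symElements A')
  obtain ⟨Z, hZ⟩ := hβ.exists_isConjugation_true conjFunctional_mem_symFunctionals
    star_mem_symElements
  let _ : StarAddMonoid M :=
    { star := Z
      star_involutive := hZ.involutive hβ fun _ => rfl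
      star_add := map_add Z }
  have _ : StarModule ℂ M := ⟨fun c x => map_smulₛₗ Z c x⟩
  have _ : IsStarCoalgebra M := isStarCoalgebra_iff.2 hZ.comul_eq
  refine ⟨M, _, _, _, inferInstance, inferInstance, inferInstance, β (),
    ⟨⟨hβ.1.isMeasuring_of_sym () rfl, fun c a => ?_⟩, fun C _ _ _ _ _ _ γ hγ => ?_⟩, hβ⟩
  · have h := LinearMap.congr_fun (hZ.act () c) (star a)
    rw [conjEnd_apply, star_star] at h
    exact h.symm
  · obtain ⟨f, hf, hf'⟩ := hβ.2 C _ hγ.isMultiMeasuring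
    refine ⟨f, ⟨hZ.map_star hβ (isStarCoalgebra_iff.1 ‹_›) f fun i c => ?_,
      fun c => LinearMap.congr_fun (hf () c)⟩,
      fun g hg => hf' g fun _ c => LinearMap.ext (hg.2 c)⟩
    rw [hf, hf]
    exact hγ.act_star c

variable {τ : Option (A →ₗ[ℂ] ℂ)} {A' : Option (Subalgebra ℂ A)}

/-- The definition tests `M` only against `∗`-coalgebras. Being isomorphic to the constructed model,
`M` inherits universality among all coalgebras, which the bialgebra argument needs. -/
theorem IsUniversalStarCoalgebra.isUniversalFamily {M : Type v} [AddCommGroup M] [Module ℂ M]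
    [Coalgebra ℂ M] [StarAddMonoid M] [StarModule ℂ M] [IsStarCoalgebra M]
    {act : M →ₗ[ℂ] Module.End ℂ A} (h : IsUniversalStarCoalgebra τ A' act) :
    IsUniversalFamily.{0, v} (fun _ : Unit => false) (fun _ _ => False) (symFunctionals τ)
      (symElements A') (fun _ => act) := by
  obtain ⟨U, _, _, _, _, _, _, γ, hU, hγ⟩ := exists_isUniversalStarCoalgebra_and τ A'
  obtain ⟨f, ⟨hfs, hf⟩, -⟩ := hU.2 M act h.1
  obtain ⟨g, ⟨hgs, hg⟩, -⟩ := h.2 U γ hU.1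
  have h1 : f.comp g = CoalgHom.id ℂ U :=
    (hU.2 U γ hU.1).unique ⟨fun c => by simp [hfs, hgs], fun c a => by simp [hf, hg]⟩
      ⟨fun _ => rfl, fun _ _ => rfl⟩
  have h2 : g.comp f = CoalgHom.id ℂ M :=
    (h.2 M act h.1).unique ⟨fun c => by simp [hfs, hgs], fun c a => by simp [hf, hg]⟩
      ⟨fun _ => rfl, fun _ _ => rfl⟩
  have h3 := hγ.of_equiv (CoalgEquiv.ofCoalgHom f g h1 h2)
  convert h3 using 2
  ext c a
  exact (hf c a).symm

theorem twComul_mul {B : Type*} [Ring B] [Bialgebra ℂ B] (b : Bool) (x y : B) :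
    twComul ℂ b (x * y) = twComul ℂ b x * twComul ℂ b y := by
  cases b
  · exact Bialgebra.comul_mul x y
  · simp only [twComul_true_apply, Bialgebra.comul_mul]
    exact map_mul (Algebra.TensorProduct.comm ℂ B B) _ _

/-- A conjugation is multiplicative or antimultiplicative, according to whether the reindexing
preserves or reverses the parity. -/
theorem IsConjugation.map_mul {ι : Type} {p : ι → Bool} {r : ι → ι → Prop}
    {T : Set (A →ₗ[ℂ] ℂ)} {S : Set A} {B : Type v} [Ring B] [Bialgebra ℂ B]
    {β : ι → B →ₗ[ℂ] Module.End ℂ A} {b : Bool} {s : ι → ι} {Z : B →ₗ⋆[ℂ] B}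
    (hZ : IsConjugation b β s Z) (hβ : IsUniversalModule.{0, v} p r T S β) (b' : Bool)
    (hs : ∀ i, p (s i) = xor b' (p i)) (x y : B) :
    Z (x * y) = bif b' then Z y * Z x else Z x * Z y := by
  refine hβ.universal.coinduction (fun z : B × B => Z (z.1 * z.2))
    (fun z => bif b' then Z z.2 * Z z.1 else Z z.1 * Z z.2)
    (fun z => ?_) (fun i z => ?_) (fun X _ _ q hq z => ?_) (x, y)
  · cases b' <;> simp [hZ.counit_eq, mul_comm]
  · have h := hβ.act_mul
    have h' := hs i
    rw [hZ.act, h, h']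
    cases b' <;> cases hi : p i <;> simp [hZ.act, h, hi]
  · obtain ⟨t, ht⟩ := exists_twComul_eq_sum (k := ℂ) b z.1
    obtain ⟨t', ht'⟩ := exists_twComul_eq_sum (k := ℂ) b z.2
    have hq' (x y : B) := hq (x, y)
    cases b'
    · simp only [cond_false, Bialgebra.comul_mul, hZ.comul_eq, twComul_mul, ht, ht',
        Finset.sum_mul_sum, map_sum, Algebra.TensorProduct.tmul_mul_tmul,
        TensorProduct.map_tmul] at hq' ⊢
      simp only [hq']
    · simp only [cond_true, Bialgebra.comul_mul, hZ.comul_eq, twComul_mul, ht, ht',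
        Finset.sum_mul_sum, map_sum, Algebra.TensorProduct.tmul_mul_tmul,
        TensorProduct.map_tmul] at hq' ⊢
      simp only [hq']
      exact Finset.sum_comm

theorem IsUniversalStarCoalgebra.exists_isUniversalStarBialgebra {M : Type v} [AddCommGroup M]
    [Module ℂ M] [Coalgebra ℂ M] [StarAddMonoid M] [StarModule ℂ M] [IsStarCoalgebra M]
    {act : M →ₗ[ℂ] Module.End ℂ A} (h : IsUniversalStarCoalgebra τ A' act) :
    ∃ (B : Type v) (_ : Ring B) (_ : Bialgebra ℂ B) (_ : StarAddMonoid B) (_ : StarModule ℂ B)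
      (_ : IsStarBialgebra B) (e : B ≃ₗc[ℂ] M) (ρ : B →ₐ[ℂ] Module.End ℂ A),
      (∀ b : B, e (star b) = star (e b)) ∧ (∀ (b : B) (a : A), ρ b a = act (e b) a) ∧
        IsUniversalStarBialgebra τ A' ρ := by
  have hM := h.isUniversalFamily
  obtain ⟨B, _, _, e, hmul, hone⟩ := hM.exists_bialgebra (by simp)
  have hB : IsUniversalModule.{0, v} _ _ _ _ _ := ⟨hM.of_equiv e, hmul, hone⟩
  -- The involution is the given one of `M`, transported along `e`, so that `e` preserves stars.
  let Z : B →ₗ⋆[ℂ] B := ((e.symm : M →ₗc[ℂ] B) : M →ₗ[ℂ] B) ∘ₛₗ starMap M ∘ₛₗ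
    ((e : B →ₗc[ℂ] M) : B →ₗ[ℂ] M)
  have heZ (b : B) : e (Z b) = star (e b) := e.apply_symm_apply (star (e b))
  have hZ : IsConjugation true (fun _ : Unit => act ∘ₗ ((e : B →ₗc[ℂ] M) : B →ₗ[ℂ] M)) id Z := by
    refine ⟨fun _ x => ?_, fun x => ?_, fun x => ?_⟩
    · change act (e (Z x)) = conjEnd (act (e x))
      rw [heZ, h.1.act_star]
    · rw [← CoalgHomClass.counit_comp_apply e (Z x), heZ, counit_star,
        CoalgHomClass.counit_comp_apply]
    · have h1 := isStarCoalgebra_iff.1 ‹IsStarCoalgebra M› (e x)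
      have h2 := CoalgHomClass.map_comp_comul_apply (e.symm : M →ₗc[ℂ] B) (starMap M (e x))
      refine h2.symm.trans ?_
      have h3 := twComul_map true (e : B →ₗc[ℂ] M) x
      rw [CoalgEquiv.coe_coe] at h3
      rw [h1, h3, TensorProduct.map_map, TensorProduct.map_map]
      rfl
  let _ : StarAddMonoid B :=
    { star := Z
      star_involutive := hZ.involutive hB.universal fun _ => rfl
      star_add := map_add Z }
  have _ : StarModule ℂ B := ⟨fun c x => map_smulₛₗ Z c x⟩
  have hsm (x y : B) : star (x * y) = star x * star y := hZ.map_mul hB false (by simp) x y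
  have hs1 : star (1 : B) = 1 := by
    have h1 := hsm 1 (star 1)
    rw [one_mul, star_star, mul_one] at h1
    exact h1.symm
  have _ : IsStarBialgebra B :=
    { isStarCoalgebra_iff.2 hZ.comul_eq with
      star_mul_same := hsm
      star_one_same := hs1 }
  refine ⟨B, _, _, inferInstance, inferInstance, inferInstance, e, hB.toAlgHom () rfl,
    heZ, fun _ _ => rfl, ⟨hB.universal.1.isMeasuring_of_sym () rfl, fun c a => ?_⟩,
    fun D _ _ _ _ _ σ hσ => ?_⟩
  · have h := LinearMap.congr_fun (hZ.act () c) (star a)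
    rw [conjEnd_apply, star_star] at h
    exact h.symm
  · obtain ⟨f, hf⟩ := hB.exists_bialgHom hσ.isMultiMeasuring (by simp) (by simp)
    refine ⟨f, ⟨hZ.map_star hB.universal (isStarCoalgebra_iff.1 inferInstance)
      (f : D →ₗc[ℂ] B) fun i c => ?_, fun c => LinearMap.congr_fun (hf () c)⟩,
      fun g hg => hB.bialgHom_ext fun i d => ?_⟩
    · exact (hf i (star c)).trans ((hσ.act_star c).trans (congrArg conjEnd (hf i c).symm))
    · rw [hf i]
      exact LinearMap.ext (hg.2 d)

end UniversalStar

/-! ### Integer powers of the antipode of a Hopf star algebra -/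

section HopfStar

variable {D : Type*} [Ring D] [HopfAlgebra ℂ D] [StarRing D] [StarModule ℂ D] [IsHopfStar D]

theorem comul_starMap (c : D) : comul (R := ℂ) (starMap D c) =
    TensorProduct.map (starMap D) (starMap D) (twComul ℂ false c) := by
  rw [starMap_apply, IsHopfStar.comul_star, star_tensor_eq, twComul_false]

/-- The antipode of a Hopf `∗`-algebra is invertible, with inverse `h ↦ S(h^*)^*`. -/
noncomputable def antipodeUnit (D : Type*) [Ring D] [HopfAlgebra ℂ D] [StarRing D]
    [StarModule ℂ D] [IsHopfStar D] : (Module.End ℂ D)ˣ where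
  val := HopfAlgebra.antipode ℂ
  inv := conjEnd (HopfAlgebra.antipode ℂ)
  val_inv := by
    ext x
    have h := IsHopfStar.star_antipode_star_antipode (star x)
    simpa using congrArg star h
  inv_val := by
    ext x
    exact IsHopfStar.star_antipode_star_antipode x

/-- Conjugation by the star is multiplicative on endomorphisms and sends the antipode to its
inverse. -/
theorem conjEnd_antipodeUnit_zpow (n : ℤ) :
    conjEnd ((antipodeUnit D ^ n : (Module.End ℂ D)ˣ) : Module.End ℂ D) =
      ((antipodeUnit D ^ (-n) : (Module.End ℂ D)ˣ) : Module.End ℂ D) := by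
  let φ : Module.End ℂ D →* Module.End ℂ D :=
    { toFun := conjEnd
      map_one' := conjEnd_one
      map_mul' := conjEnd_mul }
  have h : Units.map φ (antipodeUnit D) = (antipodeUnit D)⁻¹ := Units.ext rfl
  have h1 := congrArg Units.val (map_zpow (Units.map φ) (antipodeUnit D) n)
  rw [h, inv_zpow', Units.coe_map] at h1
  exact h1

theorem isTwistedHom_antipodeUnit_zpow (n : ℤ) :
    IsTwistedHom n.bodd ((antipodeUnit D ^ n : (Module.End ℂ D)ˣ) : Module.End ℂ D) := by
  have h1 : IsTwistedHom true ((antipodeUnit D : (Module.End ℂ D)ˣ) : Module.End ℂ D) :=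
    isTwistedHom_antipode
  have h2 : IsTwistedHom true (((antipodeUnit D)⁻¹ : (Module.End ℂ D)ˣ) : Module.End ℂ D) :=
    h1.inverse (antipodeUnit D).mul_inv (antipodeUnit D).inv_mul
  induction n using Int.induction_on with
  | zero => exact IsTwistedHom.id
  | succ n ih =>
    rw [zpow_add_one, Int.bodd_add, Units.val_mul]
    exact ih.comp h1
  | pred n ih =>
    rw [zpow_sub_one, sub_eq_add_neg (-(n : ℤ)) 1, Int.bodd_add, Int.bodd_neg 1, Units.val_mul]
    exact ih.comp h2

variable {A : Type*} [Ring A] [StarRing A] [Algebra ℂ A] [StarModule ℂ A]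
  {τ : Option (A →ₗ[ℂ] ℂ)} {A' : Option (Subalgebra ℂ A)} {σ : D →ₐ[ℂ] Module.End ℂ A}

omit [StarModule ℂ D] [IsHopfStar D] in
theorem IsHopfStarAction.act_star_antipode (h : IsHopfStarAction τ A' σ) (d : D) :
    σ (star (HopfAlgebra.antipode ℂ d)) = conjEnd (σ d) := by
  ext a
  rw [conjEnd_apply, h.star_act, star_star]

theorem IsHopfStarAction.isMultiMeasuring (h : IsHopfStarAction τ A' σ) :
    IsMultiMeasuring (fun _ : Unit => false) (fun _ _ => False) (symFunctionals τ)
      (symElements A') (fun _ => σ.toLinearMap) :=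
  h.toIsMeasuring.isMultiMeasuring_sym (fun d => star (HopfAlgebra.antipode ℂ d))
    h.act_star_antipode fun d => by
      rw [counit_star_of_comul_eq comul_starMap, HopfAlgebra.counit_antipode]

end HopfStar

/-! ### The universal Hopf star algebra -/

section UniversalHopfStar

variable {A : Type v} [Ring A] [StarRing A] [Algebra ℂ A] [StarModule ℂ A]

theorem exists_isUniversalHopfStar (τ : Option (A →ₗ[ℂ] ℂ)) (A' : Option (Subalgebra ℂ A)) :
    ∃ (H : Type v) (_ : Ring H) (_ : HopfAlgebra ℂ H) (_ : StarRing H) (_ : StarModule ℂ H)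
      (_ : IsHopfStar H) (ρ : H →ₐ[ℂ] Module.End ℂ A), IsUniversalHopfStar τ A' ρ := by
  have hp (i j : ℤ) (h : j = i + 1) : j.bodd = !i.bodd := by simp [h]
  obtain ⟨H, _, _, β, hβ⟩ := exists_isUniversalModule.{0, v} Int.bodd (fun i j => j = i + 1)
    (symFunctionals τ) (symElements A') hp
  obtain ⟨hH, rfl, hS⟩ := hβ.exists_hopfAlgebra (fun i => i + 1) (by simp) (by simp) (by simp)
  have hparity (i : ℤ) : (-1 - i).bodd = xor true i.bodd := by simp [sub_eq_add_neg]
  -- In a Hopf `∗`-algebra, `Sⁿ(h^*) = (S⁻ⁿ h)^*`, and `σ(d^*)` is the conjugate of `σ(S⁻¹ d)`. This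
  -- dictates the index `-1 - n`.
  obtain ⟨Z, hZ⟩ := hβ.universal.exists_isConjugation_false conjFunctional_mem_symFunctionals
    star_mem_symElements hp (fun i => -1 - i) (fun i => by simp [hparity])
    (by rintro i _ rfl; ring)
  have hZZ (x : H) : Z (Z x) = x := hZ.involutive hβ.universal (fun i => by ring) x
  let _ : StarRing H :=
    { star := Z
      star_involutive := hZZ
      star_add := map_add Z
      star_mul := hZ.map_mul hβ true hparity }
  have _ : StarModule ℂ H := ⟨fun c x => map_smulₛₗ Z c x⟩
  have hSZ (n : ℤ) (x : H) : β n (Z (HopfAlgebra.antipode ℂ x)) = conjEnd (β (-n) x) := by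
    rw [hZ.act]
    refine congrArg conjEnd ((hS (-1 - n) x).trans ?_)
    rw [show -1 - n + 1 = -n by ring]
  -- The map `x ↦ S(x)^*` conjugates the actions and sends index `n` to `-n`, so its square
  -- preserves every action and coinduction applies.
  have hstar (x : H) : Z (HopfAlgebra.antipode ℂ (Z (HopfAlgebra.antipode ℂ x))) = x := by
    refine hβ.universal.coinduction
      (fun x => Z (HopfAlgebra.antipode ℂ (Z (HopfAlgebra.antipode ℂ x)))) id
      (fun x => by simp [hZ.counit_eq]) (fun i x => ?_) (fun X _ _ q hq x => ?_) x
    · rw [hSZ, hSZ, conjEnd_conjEnd, neg_neg]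
      rfl
    · obtain ⟨t, ht⟩ := exists_twComul_eq_sum (k := ℂ) false x
      rw [twComul_false] at ht
      simp only [hZ.comul_eq, twComul_false, comul_antipode, ht, map_sum, TensorProduct.comm_tmul,
        TensorProduct.map_tmul, hq, id]
  have _ : IsHopfStar H := ⟨fun h => hZ.comul_eq h, hstar⟩
  refine ⟨H, _, hH, inferInstance, inferInstance, inferInstance, hβ.toAlgHom 0 rfl,
    ⟨hβ.universal.1.isMeasuring_of_sym 0 rfl, fun h a => ?_⟩, fun D _ _ _ _ _ σ hσ => ?_⟩
  · have h1 := LinearMap.congr_fun (hSZ 0 h) (star a)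
    rw [conjEnd_apply, star_star] at h1
    exact h1.symm
  · let Y (n : ℤ) : Module.End ℂ D := ((antipodeUnit D ^ n : (Module.End ℂ D)ˣ) : Module.End ℂ D)
    have hY := isTwistedHom_antipodeUnit_zpow (D := D)
    have hY1 (n : ℤ) : Y (n + 1) = HopfAlgebra.antipode ℂ ∘ₗ Y n := by
      simp only [Y]
      rw [add_comm, zpow_one_add, Units.val_mul]
      rfl
    have hYstar (n : ℤ) (d : D) : Y n (star d) = star (Y (-n) d) := by
      have h1 := LinearMap.congr_fun (conjEnd_antipodeUnit_zpow (D := D) n) d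
      rw [conjEnd_apply] at h1
      rw [← h1, star_star]
    obtain ⟨f, hf⟩ := hβ.exists_bialgHom (γ := fun i => σ.toLinearMap ∘ₗ Y i)
      (isMultiMeasuring_comp_twisted hY
      (by rintro i _ rfl; exact hY1 i) hσ.isMultiMeasuring)
      (fun i x y => by
        rw [LinearMap.comp_apply, (hY i).map_mul]
        cases i.bodd <;> simp [Y])
      (fun i => by simp [Y, (hY i).map_one])
    refine ⟨f, ⟨hZ.map_star hβ.universal comul_starMap (f : D →ₗc[ℂ] H) fun n d => ?_,
      fun d => LinearMap.congr_fun (hf 0 d)⟩, fun g hg => hβ.bialgHom_ext fun n d => ?_⟩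
    · refine (hf n (star d)).trans (Eq.trans ?_ (congrArg conjEnd (hf (-1 - n) d)).symm)
      have h1 := hσ.act_star_antipode (Y (-1 - n) d)
      have h2 := LinearMap.congr_fun (hY1 (-1 - n)) d
      rw [show -1 - n + 1 = -n by ring] at h2
      rw [LinearMap.comp_apply, hYstar, h2]
      exact h1
    · rw [hf]
      have hg1 (n : ℤ) (d : D) : β n (g (HopfAlgebra.antipode ℂ d)) = β (n + 1) (g d) := by
        rw [← hS]
        exact congrArg (β n) (antipode_bialgHom g d).symm
      have hYS (d : D) : HopfAlgebra.antipode ℂ (Y (-1) d) = d := by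
        have := LinearMap.congr_fun (hY1 (-1)) d
        exact this.symm
      -- As over `ℕ`, the action of index zero determines the others; negative indices are reached
      -- by writing `d` as the antipode of `Y (-1) d`.
      induction n using Int.induction_on generalizing d with
      | zero => exact LinearMap.ext (hg.2 d)
      | succ n ih =>
        rw [← hg1, ih]
        refine congrArg σ ?_
        have := zpow_add_one (antipodeUnit D) (n : ℤ)
        exact (LinearMap.congr_fun (congrArg Units.val this) d).symm
      | pred n ih =>
        have h1 := hg1 (-n - 1) (Y (-1) d)
        rw [hYS, sub_add_cancel, ih] at h1
        rw [h1]
        refine congrArg σ ?_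
        have := zpow_sub_one (antipodeUnit D) (-n : ℤ)
        exact (LinearMap.congr_fun (congrArg Units.val this) d).symm

end UniversalHopfStar

end Measuring

theorem mainTheorem5 :
    (∀ (k : Type u) [Field k] (A : Type v) [Ring A] [Algebra k A]
      (τ : Option (A →ₗ[k] k)) (A' : Option (Subalgebra k A)),
      (∃ (M : Type (max u v)) (_ : AddCommGroup M) (_ : Module k M) (_ : Coalgebra k M)
        (act : M →ₗ[k] Module.End k A), Measuring.IsUniversalCoalgebra τ A' act) ∧
      (∀ (M : Type (max u v)) [AddCommGroup M] [Module k M] [Coalgebra k M]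
        (act : M →ₗ[k] Module.End k A), Measuring.IsUniversalCoalgebra τ A' act →
        ∃ (B : Type (max u v)) (_ : Ring B) (_ : Bialgebra k B) (e : B ≃ₗc[k] M)
          (ρ : B →ₐ[k] Module.End k A),
          (∀ (b : B) (a : A), ρ b a = act (e b) a) ∧ Measuring.IsUniversalBialgebra τ A' ρ) ∧
      (∃ (H : Type (max u v)) (_ : Ring H) (_ : HopfAlgebra k H)
        (ρ : H →ₐ[k] Module.End k A), Measuring.IsUniversalHopf τ A' ρ)) ∧
    (∀ (A : Type v) [Ring A] [StarRing A] [Algebra ℂ A] [StarModule ℂ A]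
      (τ : Option (A →ₗ[ℂ] ℂ)) (A' : Option (Subalgebra ℂ A)),
      (∃ (M : Type v) (_ : AddCommGroup M) (_ : Module ℂ M) (_ : Coalgebra ℂ M)
        (_ : StarAddMonoid M) (_ : StarModule ℂ M) (_ : Measuring.IsStarCoalgebra M)
        (act : M →ₗ[ℂ] Module.End ℂ A), Measuring.IsUniversalStarCoalgebra τ A' act) ∧
      (∀ (M : Type v) [AddCommGroup M] [Module ℂ M] [Coalgebra ℂ M]
        [StarAddMonoid M] [StarModule ℂ M] [Measuring.IsStarCoalgebra M]
        (act : M →ₗ[ℂ] Module.End ℂ A), Measuring.IsUniversalStarCoalgebra τ A' act →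
        ∃ (B : Type v) (_ : Ring B) (_ : Bialgebra ℂ B)
          (_ : StarAddMonoid B) (_ : StarModule ℂ B) (_ : Measuring.IsStarBialgebra B)
          (e : B ≃ₗc[ℂ] M) (ρ : B →ₐ[ℂ] Module.End ℂ A),
          (∀ b : B, e (star b) = star (e b)) ∧
          (∀ (b : B) (a : A), ρ b a = act (e b) a) ∧
          Measuring.IsUniversalStarBialgebra τ A' ρ) ∧
      (∃ (H : Type v) (_ : Ring H) (_ : HopfAlgebra ℂ H)
        (_ : StarRing H) (_ : StarModule ℂ H) (_ : Measuring.IsHopfStar H)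
        (ρ : H →ₐ[ℂ] Module.End ℂ A), Measuring.IsUniversalHopfStar τ A' ρ)) := by
  refine ⟨fun k _ A _ _ τ A' => ⟨Measuring.exists_isUniversalCoalgebra τ A',
    fun M _ _ _ act h => h.exists_isUniversalBialgebra, Measuring.exists_isUniversalHopf τ A'⟩,
    fun A _ _ _ _ τ A' => ⟨?_, fun M _ _ _ _ _ _ act h => h.exists_isUniversalStarBialgebra,
      Measuring.exists_isUniversalHopfStar τ A'⟩⟩
  obtain ⟨M, i₁, i₂, i₃, i₄, i₅, i₆, act, h, -⟩ :=
    Measuring.exists_isUniversalStarCoalgebra_and τ A'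
  exact ⟨M, i₁, i₂, i₃, i₄, i₅, i₆, act, h⟩
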